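/- Let $T$ be a compact metric space, let $\mathbb{C}(T,\mathbb{R})$ be the space of real continuous functions on $T$ with the sup norm $\|\cdot\|$, and let $\mathbb{C}_0$ be its subset of non-negative functions that are not identically $0$, with its Borel $\sigma$-algebra. Let $M_p(\mathbb{C}_0)$ be the space of point measures $M=\sum_{i\in I}\delta_{f_i}$ on $\mathbb{C}_0$ with $I$ countable and $\{i\in I:\|f_i\|>\varepsilon\}$ finite for every $\varepsilon>0$, endowed with the $\sigma$-algebra generated by the maps $M\mapsto M(A)$, $A\subset\mathbb{C}_0$ Borel. Write $[M]$ for the set of atoms of $M$, and $\max(M)(t)=\max\{f(t):f\in[M]\}$ for $t\in T$, with $\max(M)\equiv 0$ if $M=0$. For $K\subset T$ and functions $f,g$ on $T$, write $f<_K g$ if $f(t)<g(t)$ for all $t\in K$, and $f\not<_K g$ otherwise, and set \[ C_K^+=\{M\in M_p(\mathbb{C}_0):\ \forall f\in[M],\ f\not<_K\max(M)\},\qquad C_K^-(g)=\{M\in M_p(\mathbb{C}_0):\ \forall f\in[M],\ f<_K g\}. \] Let $\mu$ be a Borel measure on $\mathbb{C}_0$ with $\mu(\{f:\|f\|>\varepsilon\})<\infty$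 for all $\varepsilon>0$, and let $\Phi$ be an $M_p(\mathbb{C}_0)$-valued Poisson random measure with intensity measure $\mu$, defined on a probability space $(\Omega,\mathcal{F},\mathbb{P})$. Let $K\subset T$ be closed and non-empty, and let $\Phi_K^+$ (the $K$-extremal point measure) and $\Phi_K^-$ (the $K$-sub-extremal point measure) be the restrictions of $\Phi$ to $\{f\in\mathbb{C}_0: f\not<_K\max(\Phi)\}$ and to $\{f\in\mathbb{C}_0: f<_K\max(\Phi)\}$, respectively. **Theorem 2.1.** For all measurable $A,B\subset M_p(\mathbb{C}_0)$, \[ \mathbb{P}\big[(\Phi_K^+,\Phi_K^-)\in A\times B,\ \Phi_K^+(\mathbb{C}_0)=0\big]=\exp[-\mu(\mathbb{C}_0)]\,\delta_0(A)\,\delta_0(B), \] where $\delta_0$ is the Dirac mass at the null measure and $\exp[-\infty]=0$, and, for every integer $k\ge 1$, \[ \mathbb{P}\big[(\Phi_K^+,\Phi_K^-)\in A\times B,\ \Phi_K^+(\mathbb{C}_0)=k\big] =\frac1{k!}\int_{\mathbb{C}_0^k}1_{\{\sum_{i=1}^k\delta_{f_i}\in A\cap C_K^+\}}\,\mathbb{P}\Big[\Phi\in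 B\cap C_K^-\Big(\bigvee_{i=1}^k f_i\Big)\Big]\,\mu^{\otimes k}(df_1,\ldots,df_k), \] where $\bigvee_{i=1}^k f_i$ is the pointwise maximum. -/

import Mathlib

open MeasureTheory ProbabilityTheory
open scoped ENNReal NNReal

namespace MaxID

noncomputable section

/-- The Borel `σ`-algebra of the space of continuous functions on `T` (for compact `T` the
topology is that of the sup norm). -/
instance instMeasurableSpaceC {T : Type*} [TopologicalSpace T] : MeasurableSpace C(T, ℝ) :=
  borel _

instance instBorelSpaceC {T : Type*} [TopologicalSpace T] : BorelSpace C(T, ℝ) := ⟨rfl⟩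

/-- `ℂ₀`: the non-negative and non-null continuous functions on `T`, with the subspace topology
and its Borel `σ`-algebra. -/
abbrev C0 (T : Type*) [TopologicalSpace T] : Type _ :=
  {f : C(T, ℝ) // (∀ t, 0 ≤ f t) ∧ f ≠ 0}

variable {T : Type*} [MetricSpace T] [CompactSpace T]

/-- `M` is a point measure `∑_{i ∈ I} δ_{f i}` on `ℂ₀` having, counted with multiplicity, only
finitely many points of norm larger than `ε`, for each `ε > 0`. -/
def IsPointMeasure (M : Measure (C0 T)) : Prop :=
  ∃ (I : Type) (_ : Countable I) (f : I → C0 T),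
    (∀ ε : ℝ, 0 < ε → {i | ε < ‖(f i).1‖}.Finite) ∧
      M = Measure.sum (fun i => Measure.dirac (f i))

/-- `M_p(ℂ₀)`: the space of point measures on `ℂ₀`. Its `σ`-algebra is the trace of the one of
`Measure (C0 T)`, that is, the one generated by the evaluations `M ↦ M A`, `A` Borel. -/
abbrev Mp (T : Type*) [MetricSpace T] [CompactSpace T] : Type _ :=
  {M : Measure (C0 T) // IsPointMeasure M}

theorem IsPointMeasure.zero : IsPointMeasure (0 : Measure (C0 T)) :=
  ⟨Empty, inferInstance, Empty.elim, fun _ _ => Set.toFinite _, by simp⟩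

/-- The null point measure. -/
instance instZeroMp : Zero (Mp T) := ⟨⟨0, IsPointMeasure.zero⟩⟩

theorem IsPointMeasure.restrict {M : Measure (C0 T)} (hM : IsPointMeasure M) (S : Set (C0 T)) :
    IsPointMeasure (M.restrict S) := by
  classical
  obtain ⟨I, hI, f, hf, rfl⟩ := hM
  refine ⟨{i : I // f i ∈ S}, inferInstance, fun i => f i.1, fun ε hε => ?_, ?_⟩
  · have h : {i : {i : I // f i ∈ S} | ε < ‖(f i.1).1‖} = Subtype.val ⁻¹' {i | ε < ‖(f i).1‖} := rfl
    rw [h]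
    exact (hf ε hε).preimage Subtype.val_injective.injOn
  · rw [Measure.restrict_sum_of_countable]
    ext s hs
    rw [Measure.sum_apply _ hs, Measure.sum_apply _ hs,
      ← tsum_subtype_eq_of_support_subset (s := {i | f i ∈ S})]
    · refine tsum_congr fun i => ?_
      rw [MeasureTheory.restrict_dirac, if_pos (show f i.1 ∈ S from i.2)]
    · intro i hi
      by_contra h
      apply hi
      change f i ∉ S at h
      simp [MeasureTheory.restrict_dirac, h]

/-- The restriction of a point measure to `S`: the points outside `S` are deleted. -/
def Mp.restrict (M : Mp T) (S : Set (C0 T)) : Mp T := ⟨M.1.restrict S, M.2.restrict S⟩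

/-- `∑_{i=1}^k δ_{f i}`. -/
def sumDirac {k : ℕ} (f : Fin k → C0 T) : Mp T :=
  ⟨∑ i, Measure.dirac (f i), Fin k, inferInstance, f, fun _ _ => Set.toFinite _,
    (Measure.sum_fintype _).symm⟩

/-- `[M]`: the set of atoms of `M`. -/
def atoms (M : Mp T) : Set (C0 T) := {f | M.1 {f} ≠ 0}

/-- `max(M) : t ↦ max {f t ; f ∈ [M]}`. For `M ≠ 0` the maximum is attained, since only finitely
many atoms exceed any given positive level; for `M = 0` the value is `sSup ∅ = 0`. -/
def maxFun (M : Mp T) (t : T) : ℝ := sSup ((fun f : C0 T => f.1 t) '' atoms M)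

/-- `f <_K g`: strict inequality at every point of `K`. -/
def LtOn (K : Set T) (f g : T → ℝ) : Prop := ∀ t ∈ K, f t < g t

/-- The `K`-extremal part of `M`: its points `f` with `f ≮_K max(M)`. -/
def extremalPart (K : Set T) (M : Mp T) : Mp T :=
  M.restrict {f | ¬ LtOn K f.1 (maxFun M)}

/-- The `K`-sub-extremal part of `M`: its points `f` with `f <_K max(M)`. -/
def subExtremalPart (K : Set T) (M : Mp T) : Mp T :=
  M.restrict {f | LtOn K f.1 (maxFun M)}

/-- `C_K^+`: the point measures all of whose atoms are `K`-extremal. -/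
def CPlus (K : Set T) : Set (Mp T) := {M | ∀ f ∈ atoms M, ¬ LtOn K f.1 (maxFun M)}

/-- `C_K^-(g)`: the point measures all of whose atoms are `<_K g`. -/
def CMinus (K : Set T) (g : T → ℝ) : Set (Mp T) := {M | ∀ f ∈ atoms M, LtOn K f.1 g}

/-- `Φ` is an `M_p(ℂ₀)`-valued Poisson random measure with intensity `μ`, on the probability
space `(Ω, P)`. -/
structure IsPoissonRandomMeasure {Ω : Type*} [MeasurableSpace Ω] (P : Measure Ω)
    (μ : Measure (C0 T)) (Φ : Ω → Mp T) : Prop where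
  measurable : Measurable Φ
  /-- `Φ(A)` is Poisson distributed with mean `μ(A)` if `μ(A) < ∞` … -/
  law_of_finite : ∀ A : Set (C0 T), MeasurableSet A → μ A ≠ ∞ →
    P.map (fun ω => (Φ ω).1 A) =
      (poissonMeasure (μ A).toNNReal).map (fun n : ℕ => (n : ℝ≥0∞))
  /-- … and almost surely infinite otherwise. -/
  law_of_infinite : ∀ A : Set (C0 T), MeasurableSet A → μ A = ∞ → ∀ᵐ ω ∂P, (Φ ω).1 A = ∞
  /-- The numbers of points in disjoint sets are independent. -/
  indep : ∀ (n : ℕ) (A : Fin n → Set (C0 T)), (∀ i, MeasurableSet (A i)) →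
    Pairwise (fun i j => Disjoint (A i) (A j)) →
      iIndepFun (fun i ω => (Φ ω).1 (A i)) P

end

end MaxID

open MaxID

namespace MaxID

noncomputable section

variable {T : Type*} [MetricSpace T] [CompactSpace T]

/-! ### Point measures and their atoms -/

/-! The proof rests on one deterministic fact and one distributional one.

Deterministic: on `K` the maximum of a point measure is carried by its extremal atoms, since a
positive maximum is attained and the atom attaining it is extremal (`maxFun_extremalPart`). Hence
the extremal part `M` lies in `CPlus K` and the rest `N` lies in `CMinus K (maxFun M)`. Conversely,
any pair satisfying these two conditions is the decomposition of `M + N` (`extremalPart_add`,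
`subExtremalPart_add`). The event in the theorem therefore says that the points split into `k` of
them forming such an `M` and a remainder forming such an `N`, and this splitting is unique.

Distributional: if `μ E` is finite, `Φ` has the law of a mixture over `m` of `m` points drawn from
the unnormalised measure `μ.restrict E`, weighted by `exp (-μ E) / m!`, together with an independent
copy of `Φ` outside `E` (`IsPoissonRandomMeasure.map_eq_splitLaw`). This is checked on
characteristic functionals.

Combining them, when all extremal points lie in `E` and `k + m` points fall in `E`, the event is a
disjoint union over the `k`-subsets of indices, all with the same measure by exchangeability. Since
`(k + m).choose k / (k + m)! = 1 / (k! m!)`, the factor `1 / k!` comes out, and the sum over `m` of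
the remaining terms rebuilds the law of `Φ` (`IsPoissonRandomMeasure.measure_extremalEvent`).
Letting `E` increase through the norm levels removes the restriction. The null case is a void
probability. -/

theorem IsPointMeasure.add {M N : Measure (C0 T)} (hM : IsPointMeasure M) (hN : IsPointMeasure N) :
    IsPointMeasure (M + N) := by
  obtain ⟨I, hI, f, hf, rfl⟩ := hM
  obtain ⟨J, hJ, g, hg, rfl⟩ := hN
  refine ⟨I ⊕ J, inferInstance, Sum.elim f g, fun ε hε => ?_, ?_⟩
  · refine (((hf ε hε).image Sum.inl).union ((hg ε hε).image Sum.inr)).subset ?_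
    rintro (i | j) h
    · exact Or.inl ⟨i, h, rfl⟩
    · exact Or.inr ⟨j, h, rfl⟩
  · ext s hs
    rw [Measure.add_apply, Measure.sum_apply _ hs, Measure.sum_apply _ hs, Measure.sum_apply _ hs,
      ENNReal.summable.tsum_sum (f := fun i => Measure.dirac (Sum.elim f g i) s)
        ENNReal.summable]
    rfl

instance instAddMp : Add (Mp T) := ⟨fun M N => ⟨M.1 + N.1, M.2.add N.2⟩⟩

theorem Mp.coe_add (M N : Mp T) : (M + N).1 = M.1 + N.1 := rfl

theorem Mp.coe_restrict (M : Mp T) (S : Set (C0 T)) : (M.restrict S).1 = M.1.restrict S := rfl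

theorem Mp.coe_zero : (0 : Mp T).1 = 0 := rfl

theorem coe_sumDirac {k : ℕ} (f : Fin k → C0 T) :
    (sumDirac f).1 = ∑ i, Measure.dirac (f i) := rfl

theorem norm_C0_pos (f : C0 T) : 0 < ‖f.1‖ := norm_pos_iff.2 f.2.2

/-- A countable sum of Dirac masses charges only its atoms. Measurability of `S` plays no role, so
atoms can be sorted into extremal and sub-extremal ones before any measurability is known. -/
theorem Mp.apply_eq_zero_iff (M : Mp T) (S : Set (C0 T)) :
    M.1 S = 0 ↔ ∀ f ∈ S, f ∉ atoms M := by
  constructor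
  · intro h f hf
    simpa [atoms] using measure_mono_null (Set.singleton_subset_iff.2 hf) h
  · intro h
    obtain ⟨M, I, hI, g, hg, rfl⟩ := M
    simp only [Measure.sum_apply_of_countable, ENNReal.tsum_eq_zero]
    intro i
    rw [Measure.dirac_apply, Set.indicator_apply_eq_zero]
    intro hi
    refine absurd ?_ (h _ hi)
    simp only [atoms, Set.mem_ofPred_eq, Measure.sum_apply_of_countable, ne_eq,
      ENNReal.tsum_eq_zero, not_forall]
    exact ⟨i, by simp⟩

theorem Mp.one_le_apply (M : Mp T) {S : Set (C0 T)} (h : M.1 S ≠ 0) : 1 ≤ M.1 S := by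
  obtain ⟨M, I, hI, g, hg, rfl⟩ := M
  simp only [Measure.sum_apply_of_countable, ne_eq, ENNReal.tsum_eq_zero, not_forall] at h ⊢
  obtain ⟨i, hi⟩ := h
  refine le_trans ?_ (ENNReal.le_tsum i)
  rw [Measure.dirac_apply] at hi ⊢
  rw [Set.indicator_of_mem (Set.mem_of_indicator_ne_zero hi)]
  rfl

theorem Mp.apply_norm_gt_lt_top (M : Mp T) {ε : ℝ} (hε : 0 < ε) : M.1 {f | ε < ‖f.1‖} < ∞ := by
  obtain ⟨M, I, hI, g, hg, rfl⟩ := M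
  simp only [Measure.sum_apply_of_countable]
  rw [tsum_eq_sum (s := (hg ε hε).toFinset)]
  · exact ENNReal.sum_lt_top.2 fun i _ => measure_lt_top _ _
  · intro i hi
    rw [Measure.dirac_apply]
    exact Set.indicator_of_notMem (fun h => hi ((hg ε hε).mem_toFinset.2 h)) 1

theorem finite_atoms_norm_gt (M : Mp T) {ε : ℝ} (hε : 0 < ε) :
    {f ∈ atoms M | ε < ‖f.1‖}.Finite := by
  obtain ⟨M, I, hI, g, hg, rfl⟩ := M
  refine ((hg ε hε).image g).subset ?_
  rintro f ⟨hf, hfε⟩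
  simp only [atoms, Set.mem_ofPred_eq, Measure.sum_apply_of_countable, ne_eq,
      ENNReal.tsum_eq_zero, not_forall] at hf
  obtain ⟨i, hi⟩ := hf
  rw [Measure.dirac_apply] at hi
  have : g i = f := by simpa using Set.mem_of_indicator_ne_zero hi
  exact ⟨i, by simpa [this] using hfε, this⟩

theorem atoms_add (M N : Mp T) : atoms (M + N) = atoms M ∪ atoms N := by
  ext f
  simp only [atoms, Mp.coe_add, Measure.add_apply, Set.mem_ofPred_eq, Set.mem_union, ne_eq,
    add_eq_zero, not_and_or]

theorem atoms_restrict (M : Mp T) (S : Set (C0 T)) : atoms (M.restrict S) = atoms M ∩ S := by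
  ext f
  simp only [atoms, Mp.coe_restrict, Set.mem_ofPred_eq, Set.mem_inter_iff,
    Measure.restrict_apply (measurableSet_singleton f)]
  by_cases hf : f ∈ S
  · simp [hf]
  · simp [hf, Set.singleton_inter_eq_empty.2 hf]

theorem atoms_sumDirac {k : ℕ} (f : Fin k → C0 T) : atoms (sumDirac f) = Set.range f := by
  ext g
  simp only [atoms, coe_sumDirac, Set.mem_ofPred_eq, Measure.coe_finsetSum, Finset.sum_apply, ne_eq,
    Finset.sum_eq_zero_iff, Finset.mem_univ, true_imp_iff, not_forall, Set.mem_range,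
    Measure.dirac_apply, Set.indicator_apply_eq_zero, Set.mem_singleton_iff]
  simp

theorem atoms_zero : atoms (0 : Mp T) = ∅ := by
  ext f; simp [atoms, Mp.coe_zero]

theorem Mp.eq_zero_iff (M : Mp T) : M = 0 ↔ atoms M = ∅ := by
  constructor
  · rintro rfl; exact atoms_zero
  · intro h
    refine Subtype.ext (Measure.measure_univ_eq_zero.1 ?_)
    rw [Mp.apply_eq_zero_iff]
    simp [h]

theorem Mp.restrict_eq_self (M : Mp T) {S : Set (C0 T)} (h : atoms M ⊆ S) : M.restrict S = M := by
  refine Subtype.ext ?_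
  rw [Mp.coe_restrict, Measure.restrict_eq_self_of_ae_mem]
  rw [ae_iff, Mp.apply_eq_zero_iff]
  exact fun f hf hf' => hf (h hf')

theorem Mp.restrict_eq_zero (M : Mp T) {S : Set (C0 T)} (h : Disjoint (atoms M) S) :
    M.restrict S = 0 := by
  rw [Mp.eq_zero_iff, atoms_restrict]
  exact h.inter_eq

theorem Mp.restrict_add (M N : Mp T) (S : Set (C0 T)) :
    (M + N).restrict S = M.restrict S + N.restrict S :=
  Subtype.ext (Measure.restrict_add _ _ _)

theorem Mp.add_zero' (M : Mp T) : M + 0 = M := Subtype.ext (add_zero M.1)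

theorem Mp.zero_add' (M : Mp T) : 0 + M = M := Subtype.ext (zero_add M.1)

theorem Mp.add_assoc' (M N L : Mp T) : M + N + L = M + (N + L) :=
  Subtype.ext (add_assoc M.1 N.1 L.1)

/-! ### The pointwise maximum of a point measure -/

theorem bddAbove_eval_atoms (M : Mp T) (t : T) :
    BddAbove ((fun f : C0 T => f.1 t) '' atoms M) := by
  obtain ⟨b, hb⟩ := ((finite_atoms_norm_gt M one_pos).image (fun f : C0 T => f.1 t)).bddAbove
  refine ⟨max b 1, ?_⟩
  rintro _ ⟨f, hf, rfl⟩
  by_cases h : 1 < ‖f.1‖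
  · exact le_max_of_le_left (hb ⟨f, ⟨hf, h⟩, rfl⟩)
  · exact le_max_of_le_right
      ((le_abs_self _).trans ((f.1.norm_coe_le_norm t).trans (not_lt.1 h)))

theorem le_maxFun {M : Mp T} {f : C0 T} (hf : f ∈ atoms M) (t : T) : f.1 t ≤ maxFun M t :=
  le_csSup (bddAbove_eval_atoms M t) ⟨f, hf, rfl⟩

theorem maxFun_nonneg (M : Mp T) (t : T) : 0 ≤ maxFun M t := by
  refine Real.sSup_nonneg ?_
  rintro _ ⟨f, -, rfl⟩
  exact f.2.1 t

theorem maxFun_mono {M N : Mp T} (h : atoms M ⊆ atoms N) (t : T) : maxFun M t ≤ maxFun N t := by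
  refine Real.sSup_le ?_ (maxFun_nonneg N t)
  rintro _ ⟨f, hf, rfl⟩
  exact le_maxFun (h hf) t

theorem lt_maxFun_iff (M : Mp T) (t : T) {a : ℝ} (ha : 0 ≤ a) :
    a < maxFun M t ↔ ∃ g ∈ atoms M, a < g.1 t := by
  constructor
  · intro h
    have hne : ((fun f : C0 T => f.1 t) '' atoms M).Nonempty := by
      by_contra h0
      rw [Set.not_nonempty_iff_eq_empty] at h0
      rw [maxFun, h0, Real.sSup_empty] at h
      exact absurd h (not_lt.2 ha)
    obtain ⟨_, ⟨g, hg, rfl⟩, h⟩ := exists_lt_of_lt_csSup hne h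
    exact ⟨g, hg, h⟩
  · rintro ⟨g, hg, h⟩
    exact h.trans_le (le_maxFun hg t)

/-- Only finitely many atoms exceed half the maximum at `t`, and the largest of these attains the
supremum. -/
theorem exists_atom_eq_maxFun (M : Mp T) (t : T) (h : 0 < maxFun M t) :
    ∃ g ∈ atoms M, g.1 t = maxFun M t := by
  have hfin : {f ∈ atoms M | maxFun M t / 2 < f.1 t}.Finite :=
    (finite_atoms_norm_gt M (half_pos h)).subset fun f hf =>
      ⟨hf.1, hf.2.trans_le ((le_abs_self _).trans (f.1.norm_coe_le_norm t))⟩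
  obtain ⟨g₀, hg₀, hg₀'⟩ := (lt_maxFun_iff M t (half_pos h).le).1 (half_lt_self h)
  obtain ⟨g, hg, hmax⟩ := hfin.exists_maximalFor (fun f : C0 T => f.1 t) _ ⟨g₀, hg₀, hg₀'⟩
  refine ⟨g, hg.1, (le_maxFun hg.1 t).antisymm (not_lt.1 fun hlt => ?_)⟩
  obtain ⟨f, hf, hf'⟩ := (lt_maxFun_iff M t (g.2.1 t)).1 hlt
  exact absurd (hmax ⟨hf, hg.2.trans hf'⟩ hf'.le) (not_le.2 hf')

theorem maxFun_sumDirac {k : ℕ} (f : Fin k → C0 T) :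
    maxFun (sumDirac f) = fun t => ⨆ i, (f i).1 t := by
  funext t
  rw [maxFun, atoms_sumDirac, ← Set.range_comp]
  rfl

/-! ### Extremal and sub-extremal parts -/

variable {K : Set T}

theorem LtOn.mono_right {T : Type*} {K : Set T} {f g h : T → ℝ} (hfg : LtOn K f g) (hgh : ∀ t ∈ K, g t ≤ h t) :
    LtOn K f h := fun t ht => (hfg t ht).trans_le (hgh t ht)

theorem atoms_extremalPart (M : Mp T) :
    atoms (extremalPart K M) = {f ∈ atoms M | ¬ LtOn K f.1 (maxFun M)} :=
  atoms_restrict _ _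

theorem atoms_subExtremalPart (M : Mp T) :
    atoms (subExtremalPart K M) = {f ∈ atoms M | LtOn K f.1 (maxFun M)} :=
  atoms_restrict _ _

theorem extremalPart_mem_CPlus (M : Mp T) : extremalPart K M ∈ CPlus K := by
  intro f hf hlt
  have hsub : atoms (extremalPart K M) ⊆ atoms M := by
    rw [atoms_extremalPart]; exact Set.sep_subset _ _
  rw [atoms_extremalPart] at hf
  exact hf.2 (hlt.mono_right fun t _ => maxFun_mono hsub t)

theorem maxFun_extremalPart (M : Mp T) {t : T} (ht : t ∈ K) :
    maxFun (extremalPart K M) t = maxFun M t := by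
  have hsub : atoms (extremalPart K M) ⊆ atoms M := by
    rw [atoms_extremalPart]; exact Set.sep_subset _ _
  refine (maxFun_mono hsub t).antisymm ?_
  rcases (maxFun_nonneg M t).eq_or_lt with h | h
  · rw [← h]; exact maxFun_nonneg _ _
  · obtain ⟨g, hg, hgt⟩ := exists_atom_eq_maxFun M t h
    rw [← hgt]
    refine le_maxFun ?_ t
    rw [atoms_extremalPart]
    exact ⟨hg, fun hlt => (hlt t ht).ne hgt⟩

theorem subExtremalPart_mem_CMinus (M : Mp T) :
    subExtremalPart K M ∈ CMinus K (maxFun (extremalPart K M)) := by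
  intro f hf
  rw [atoms_subExtremalPart] at hf
  exact hf.2.mono_right fun t ht => (maxFun_extremalPart M ht).ge

theorem maxFun_add_of_mem_CMinus {M N : Mp T} (hN : N ∈ CMinus K (maxFun M)) {t : T} (ht : t ∈ K) :
    maxFun (M + N) t = maxFun M t := by
  refine le_antisymm ?_ (maxFun_mono (by rw [atoms_add]; exact Set.subset_union_left) t)
  refine Real.sSup_le ?_ (maxFun_nonneg M t)
  rintro _ ⟨f, hf, rfl⟩
  rw [atoms_add] at hf
  rcases hf with hf | hf
  · exact le_maxFun hf t
  · exact (hN f hf t ht).le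

/-- Adding `N` does not change the maximum on `K`, so each atom of `M` stays extremal and each atom
of `N` stays strictly below. -/
theorem extremalPart_add {M N : Mp T} (hM : M ∈ CPlus K) (hN : N ∈ CMinus K (maxFun M)) :
    extremalPart K (M + N) = M := by
  rw [extremalPart, Mp.restrict_add, Mp.restrict_eq_self M, Mp.restrict_eq_zero N, Mp.add_zero']
  · rw [Set.disjoint_left]
    exact fun f hf h => h ((hN f hf).mono_right fun t ht => (maxFun_add_of_mem_CMinus hN ht).ge)
  · exact fun f hf h => hM f hf (h.mono_right fun t ht => (maxFun_add_of_mem_CMinus hN ht).le)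

theorem subExtremalPart_add {M N : Mp T} (hM : M ∈ CPlus K) (hN : N ∈ CMinus K (maxFun M)) :
    subExtremalPart K (M + N) = N := by
  rw [subExtremalPart, Mp.restrict_add, Mp.restrict_eq_self N, Mp.restrict_eq_zero M,
    Mp.zero_add']
  · rw [Set.disjoint_left]
    exact fun f hf h => hM f hf (h.mono_right fun t ht => (maxFun_add_of_mem_CMinus hN ht).le)
  · exact fun f hf => (hN f hf).mono_right fun t ht => (maxFun_add_of_mem_CMinus hN ht).ge

/-- If no atom is extremal, the maximum vanishes at each point of `K`. An atom is non-negative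
there, hence not strictly below the maximum, so it would itself be extremal. -/
theorem extremalPart_apply_univ_eq_zero_iff (hK : K.Nonempty) (M : Mp T) :
    (extremalPart K M).1 Set.univ = 0 ↔ M = 0 := by
  rw [Measure.measure_univ_eq_zero]
  have h0 : (extremalPart K M).1 = 0 ↔ extremalPart K M = 0 := by
    rw [Subtype.ext_iff]; rfl
  rw [h0]
  constructor
  · intro h
    obtain ⟨t, ht⟩ := hK
    rw [Mp.eq_zero_iff, Set.eq_empty_iff_forall_notMem]
    intro f hf
    have hmax := maxFun_extremalPart (K := K) M ht
    rw [h, maxFun, atoms_zero, Set.image_empty, Real.sSup_empty] at hmax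
    have : f ∈ atoms (extremalPart K M) := by
      rw [atoms_extremalPart]
      refine ⟨hf, fun hlt => ?_⟩
      have := hlt t ht
      rw [← hmax] at this
      exact absurd this (not_lt.2 (f.2.1 t))
    rw [h, atoms_zero] at this
    exact this
  · rintro rfl
    rw [Mp.eq_zero_iff, atoms_extremalPart, atoms_zero]
    simp

/-! ### Levels of the norm -/

/-- The functions of norm larger than `1 / (n + 1)`. -/
def level (T : Type*) [MetricSpace T] [CompactSpace T] (n : ℕ) : Set (C0 T) :=
  {f | 1 / ((n : ℝ) + 1) < ‖f.1‖}

theorem measurableSet_level (n : ℕ) : MeasurableSet (level T n) :=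
  (isOpen_lt continuous_const (continuous_norm.comp continuous_subtype_val)).measurableSet

theorem monotone_level : Monotone (level T) := fun m n h f hf => by
  have hle : (1 : ℝ) / ((n : ℝ) + 1) ≤ 1 / ((m : ℝ) + 1) := Nat.one_div_le_one_div h
  exact hle.trans_lt hf

theorem iUnion_level : ⋃ n, level T n = Set.univ :=
  Set.eq_univ_of_forall fun f =>
    Set.mem_iUnion.2 (exists_nat_one_div_lt (norm_C0_pos f))

theorem Mp.apply_level_lt_top (M : Mp T) (n : ℕ) : M.1 (level T n) < ∞ :=
  M.apply_norm_gt_lt_top Nat.one_div_pos_of_nat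

theorem apply_eq_iSup_level (M : Measure (C0 T)) (A : Set (C0 T)) :
    M A = ⨆ n, M (A ∩ level T n) := by
  have hmono : Monotone fun n => A ∩ level T n := fun _ _ h =>
    Set.inter_subset_inter_right A (monotone_level h)
  rw [← hmono.measure_iUnion, ← Set.inter_iUnion, iUnion_level, Set.inter_univ]

/-! ### Measurability -/

theorem measurable_eval {T : Type*} [TopologicalSpace T] (t : T) :
    Measurable fun f : C0 T => f.1 t :=
  ((continuous_eval_const t).comp continuous_subtype_val).measurable

theorem measurable_Mp_apply {A : Set (C0 T)} (hA : MeasurableSet A) :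
    Measurable fun M : Mp T => M.1 A :=
  (Measure.measurable_coe hA).comp measurable_subtype_coe

theorem measurable_Mp_of_measurable_apply {Y : Type*} [MeasurableSpace Y] {N : Y → Mp T}
    (h : ∀ A, MeasurableSet A → Measurable fun y => (N y).1 A) : Measurable N :=
  (Measure.measurable_of_measurable_coe _ h).subtype_mk

/-- A Dynkin class argument. It is run inside one norm level at a time, where all counts are finite
and complements can be handled by subtraction. -/
theorem measurable_apply_section {Y : Type*} [MeasurableSpace Y] {N : Y → Mp T}
    (hN : Measurable N) {S : Set (C0 T × Y)} (hS : MeasurableSet S) :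
    Measurable fun y => (N y).1 {f | (f, y) ∈ S} := by
  have hsec : ∀ {S : Set (C0 T × Y)} (y : Y), MeasurableSet S →
      MeasurableSet {f | (f, y) ∈ S} := fun y hS => measurable_prodMk_right hS
  have key : ∀ n, Measurable fun y => (N y).1 ({f | (f, y) ∈ S} ∩ level T n) := by
    intro n
    induction S, hS using MeasurableSpace.induction_on_inter generateFrom_prod.symm
      isPiSystem_prod with
    | empty => simp
    | basic S hS =>
      obtain ⟨s, hs, t, ht, rfl⟩ := hS
      have hs : MeasurableSet s := hs
      have : (fun y => (N y).1 ({f | (f, y) ∈ s ×ˢ t} ∩ level T n)) =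
          t.indicator fun y => (N y).1 (s ∩ level T n) := by
        funext y
        by_cases hy : y ∈ t <;> simp [hy]
      rw [this]
      exact ((measurable_Mp_apply (hs.inter (measurableSet_level n))).comp hN).indicator ht
    | compl S hS ih =>
      have : (fun y => (N y).1 ({f | (f, y) ∈ Sᶜ} ∩ level T n)) = fun y =>
          (N y).1 (level T n) - (N y).1 ({f | (f, y) ∈ S} ∩ level T n) := by
        funext y
        rw [← measure_sdiff Set.inter_subset_right
          ((hsec y hS).inter (measurableSet_level n)).nullMeasurableSet
          ((measure_mono Set.inter_subset_right).trans_lt ((N y).apply_level_lt_top n)).ne]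
        congr 1
        ext f
        simp only [Set.mem_inter_iff, Set.mem_ofPred_eq, Set.mem_compl_iff, Set.mem_sdiff]
        tauto
      rw [this]
      exact ((measurable_Mp_apply (measurableSet_level n)).comp hN).sub ih
    | iUnion S hd hS ih =>
      have : (fun y => (N y).1 ({f | (f, y) ∈ ⋃ i, S i} ∩ level T n)) = fun y =>
          ∑' i, (N y).1 ({f | (f, y) ∈ S i} ∩ level T n) := by
        funext y
        rw [← measure_iUnion]
        · congr 1
          ext f
          simp
        · exact fun i j hij => Disjoint.mono Set.inter_subset_left Set.inter_subset_left
            ((hd hij).preimage fun f => (f, y))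
        · exact fun i => (hsec y (hS i)).inter (measurableSet_level n)
      rw [this]
      exact Measurable.tsum ih
  simp_rw [apply_eq_iSup_level (N _).1 {f | (f, _) ∈ S}]
  exact Measurable.iSup key

/-- Compactness of `K` turns the pointwise strict inequality into one with a uniform rational gap
`δ`, which can be tested on a dense sequence. The right-hand side is thus a countable combination of
measurable conditions on `(f, M)`. -/
theorem ltOn_maxFun_iff {K : Set T} (hK : IsClosed K) {d : ℕ → K} (hd : DenseRange d) (f : C0 T)
    (M : Mp T) :
    LtOn K f.1 (maxFun M) ↔ ∃ δ : ℚ, 0 < δ ∧ ∀ n, ∃ q : ℚ, f.1 (d n) + δ < q ∧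
      M.1 {g | (q : ℝ) < g.1 (d n)} ≠ 0 := by
  constructor
  · intro h
    -- These open sets, where some atom beats `f` by more than `1 / (n + 1)`, increase and cover
    -- `K`; a single one then suffices and supplies the gap.
    let V : ℕ → Set T := fun n => ⋃ g ∈ atoms M, {s | f.1 s + 1 / ((n : ℝ) + 1) < g.1 s}
    have hVo : ∀ n, IsOpen (V n) := fun n => isOpen_biUnion fun g _ =>
      isOpen_lt (f.1.continuous.add continuous_const) g.1.continuous
    have hVm : Monotone V := fun m n hmn => Set.iUnion₂_mono fun g _ s hs => by
      have hle : (1 : ℝ) / ((n : ℝ) + 1) ≤ 1 / ((m : ℝ) + 1) := Nat.one_div_le_one_div hmn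
      have hlt : f.1 s + 1 / ((m : ℝ) + 1) < g.1 s := hs
      change f.1 s + 1 / ((n : ℝ) + 1) < g.1 s
      linarith
    have hcov : K ⊆ ⋃ n, V n := by
      intro t ht
      obtain ⟨g, hg, hlt⟩ := (lt_maxFun_iff M t (f.2.1 t)).1 (h t ht)
      obtain ⟨n, hn⟩ := exists_nat_one_div_lt (sub_pos.2 hlt)
      refine Set.mem_iUnion.2 ⟨n, Set.mem_iUnion₂.2 ⟨g, hg, ?_⟩⟩
      change f.1 t + 1 / ((n : ℝ) + 1) < g.1 t
      linarith
    obtain ⟨n, hn⟩ := hK.isCompact.elim_directed_cover V hVo hcov hVm.directed_le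
    refine ⟨1 / ((n : ℚ) + 1), Nat.one_div_pos_of_nat, fun m => ?_⟩
    obtain ⟨g, hg, hlt⟩ := Set.mem_iUnion₂.1 (hn (d m).2)
    obtain ⟨q, hq, hq'⟩ := exists_rat_btwn (show f.1 (d m) + 1 / ((n : ℝ) + 1) < g.1 (d m) from hlt)
    refine ⟨q, by push_cast; exact hq, fun h0 => ?_⟩
    exact (M.apply_eq_zero_iff _).1 h0 g hq' hg
  · rintro ⟨δ, hδ, h⟩ t ht
    have hδ' : (0 : ℝ) < δ := by exact_mod_cast hδ
    -- As `f` is non-negative, an atom exceeding `f` by more than `δ` somewhere has norm above `δ`.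
    -- Only finitely many atoms qualify, so `C` is closed, and density of `d` gives all of `K`.
    let C : Set K := ⋃ g ∈ {g ∈ atoms M | (δ : ℝ) < ‖g.1‖}, {s : K | f.1 s + δ ≤ g.1 s}
    have hC : IsClosed C := (finite_atoms_norm_gt M hδ').isClosed_biUnion fun g _ =>
      isClosed_le ((f.1.continuous.comp continuous_subtype_val).add continuous_const)
        (g.1.continuous.comp continuous_subtype_val)
    have hmem : ∀ s : K, s ∈ C := by
      intro s
      refine hd.induction_on (p := fun s => s ∈ C) s hC fun n => ?_
      obtain ⟨q, hq, hM⟩ := h n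
      rw [ne_eq, Mp.apply_eq_zero_iff] at hM
      push Not at hM
      obtain ⟨g, hg, hgM⟩ := hM
      have hg' : (q : ℝ) < g.1 (d n) := hg
      refine Set.mem_iUnion₂.2 ⟨g, ⟨hgM, ?_⟩, (hq.trans hg').le⟩
      have := f.2.1 (d n)
      have := (le_abs_self _).trans (g.1.norm_coe_le_norm (d n))
      linarith
    obtain ⟨g, hg, hle⟩ := Set.mem_iUnion₂.1 (hmem ⟨t, ht⟩)
    have hle' : f.1 t + δ ≤ g.1 t := hle
    have := le_maxFun hg.1 t
    linarith

theorem measurableSet_ltOn_maxFun {K : Set T} (hK : IsClosed K) (hK' : K.Nonempty) :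
    MeasurableSet {p : C0 T × Mp T | LtOn K p.1.1 (maxFun p.2)} := by
  have : Nonempty K := hK'.to_subtype
  have hd := TopologicalSpace.denseRange_denseSeq K
  simp_rw [ltOn_maxFun_iff hK hd]
  have hset : {p : C0 T × Mp T | ∃ δ : ℚ, 0 < δ ∧ ∀ n, ∃ q : ℚ,
      p.1.1 (TopologicalSpace.denseSeq K n) + δ < q ∧
      p.2.1 {g | (q : ℝ) < g.1 (TopologicalSpace.denseSeq K n)} ≠ 0} =
      ⋃ δ : ℚ, ⋃ _ : 0 < δ, ⋂ n, ⋃ q : ℚ,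
        ({p : C0 T × Mp T | p.1.1 (TopologicalSpace.denseSeq K n) + δ < q} ∩
        {p : C0 T × Mp T | p.2.1 {g | (q : ℝ) < g.1 (TopologicalSpace.denseSeq K n)} = 0}ᶜ) := by
    ext p
    simp
  rw [hset]
  refine MeasurableSet.iUnion fun δ => MeasurableSet.iUnion fun _ => MeasurableSet.iInter fun n =>
    MeasurableSet.iUnion fun q => MeasurableSet.inter ?_ (MeasurableSet.compl ?_)
  · exact measurableSet_lt (((measurable_eval _).comp measurable_fst).add_const _) measurable_const
  · exact ((measurable_Mp_apply (measurableSet_lt measurable_const (measurable_eval _))).comp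
      measurable_snd) (measurableSet_singleton 0)

theorem measurable_restrict_section {S : Set (C0 T × Mp T)} (hS : MeasurableSet S) :
    Measurable fun M : Mp T => M.restrict {f | (f, M) ∈ S} := by
  refine measurable_Mp_of_measurable_apply fun A hA => ?_
  simp_rw [Mp.coe_restrict, Measure.restrict_apply hA]
  exact measurable_apply_section measurable_id ((measurable_fst hA).inter hS)

theorem measurable_extremalPart (hK : IsClosed K) (hK' : K.Nonempty) :
    Measurable (extremalPart (T := T) K) :=
  measurable_restrict_section (measurableSet_ltOn_maxFun hK hK').compl

theorem measurable_subExtremalPart (hK : IsClosed K) (hK' : K.Nonempty) :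
    Measurable (subExtremalPart (T := T) K) :=
  measurable_restrict_section (measurableSet_ltOn_maxFun hK hK')

theorem measurableSet_mem_CMinus_maxFun (hK : IsClosed K) (hK' : K.Nonempty) :
    MeasurableSet {p : Mp T × Mp T | p.2 ∈ CMinus K (maxFun p.1)} := by
  have hset : {p : Mp T × Mp T | p.2 ∈ CMinus K (maxFun p.1)} =
      {p | p.2.1 {f | (f, p) ∈ {x : C0 T × Mp T × Mp T | LtOn K x.1.1 (maxFun x.2.1)}ᶜ} = 0} := by
    ext p
    simp only [Set.mem_ofPred_eq, Mp.apply_eq_zero_iff, CMinus, Set.mem_compl_iff]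
    exact forall_congr' fun f => by tauto
  rw [hset]
  refine measurable_apply_section measurable_snd (MeasurableSet.compl ?_)
    (measurableSet_singleton 0)
  exact (measurable_fst.prodMk (measurable_fst.comp measurable_snd))
    (measurableSet_ltOn_maxFun hK hK')

theorem measurableSet_CPlus (hK : IsClosed K) (hK' : K.Nonempty) :
    MeasurableSet (CPlus (T := T) K) := by
  have hset : CPlus (T := T) K =
      {M | M.1 {f | (f, M) ∈ {x : C0 T × Mp T | LtOn K x.1.1 (maxFun x.2)}} = 0} := by
    ext M
    simp only [Set.mem_ofPred_eq, Mp.apply_eq_zero_iff, CPlus]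
    exact forall_congr' fun f => by tauto
  rw [hset]
  exact measurable_apply_section measurable_id (measurableSet_ltOn_maxFun hK hK')
    (measurableSet_singleton 0)

theorem measurable_sumDirac (k : ℕ) : Measurable (sumDirac : (Fin k → C0 T) → Mp T) := by
  refine measurable_Mp_of_measurable_apply fun A hA => ?_
  simp only [coe_sumDirac, Measure.coe_finsetSum, Finset.sum_apply]
  exact Finset.measurable_sum _ fun i _ =>
    ((Measure.measurable_coe hA).comp Measure.measurable_dirac).comp (measurable_pi_apply i)

theorem measurable_add_Mp : Measurable fun p : Mp T × Mp T => p.1 + p.2 := by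
  refine measurable_Mp_of_measurable_apply fun A hA => ?_
  simp only [Mp.coe_add, Measure.add_apply]
  exact ((measurable_Mp_apply hA).comp measurable_fst).add
    ((measurable_Mp_apply hA).comp measurable_snd)

theorem measurable_restrict_Mp {S : Set (C0 T)} (hS : MeasurableSet S) :
    Measurable fun M : Mp T => M.restrict S := by
  refine measurable_Mp_of_measurable_apply fun A hA => ?_
  simp_rw [Mp.coe_restrict, Measure.restrict_apply hA]
  exact measurable_Mp_apply (hA.inter hS)

/-! ### Characteristic functionals of random point measures -/

theorem integrable_of_support_subset_level (M : Mp T) {n : ℕ} {g : SimpleFunc (C0 T) ℝ}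
    (hg : Function.support g ⊆ level T n) : Integrable g M.1 :=
  SimpleFunc.integrable_iff.2 fun y hy =>
    (measure_mono fun f (hf : g f = y) => hg (by rw [Function.mem_support, hf]; exact hy)).trans_lt
      (M.apply_level_lt_top n)

theorem integral_simpleFunc_eq_sum (M : Mp T) {n : ℕ} {g : SimpleFunc (C0 T) ℝ}
    (hg : Function.support g ⊆ level T n) :
    ∫ f, g f ∂M.1 = ∑ c : {c // c ∈ g.range.filter (· ≠ 0)}, (M.1 (g ⁻¹' {c.1})).toReal * c.1 := by
  rw [← SimpleFunc.integral_eq_integral g (integrable_of_support_subset_level M hg),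
    SimpleFunc.integral_eq_sum_filter, ← Finset.sum_coe_sort]
  rfl

theorem measurable_integral_simpleFunc {n : ℕ} {g : SimpleFunc (C0 T) ℝ}
    (hg : Function.support g ⊆ level T n) : Measurable fun M : Mp T => ∫ f, g f ∂M.1 := by
  simp_rw [integral_simpleFunc_eq_sum _ hg]
  exact Finset.measurable_sum _ fun c _ =>
    (measurable_Mp_apply (g.measurableSet_fiber c.1)).ennreal_toReal.mul_const _

theorem measurable_exp_integral {n : ℕ} {g : SimpleFunc (C0 T) ℝ}
    (hg : Function.support g ⊆ level T n) :
    Measurable fun M : Mp T => Complex.exp ((∫ f, g f ∂M.1 : ℝ) * Complex.I) :=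
  Complex.measurable_exp.comp
    ((Complex.measurable_ofReal.comp (measurable_integral_simpleFunc hg)).mul_const _)

/-- The measurable sets contained in some level set, indexing the finite counts. -/
abbrev LevelSet (T : Type*) [MetricSpace T] [CompactSpace T] : Type _ :=
  {A : Set (C0 T) // MeasurableSet A ∧ ∃ n, A ⊆ level T n}

/-- The finite counts of a point measure. -/
def counts (M : Mp T) (A : LevelSet T) : ℝ := (M.1 A.1).toReal

theorem measurable_counts : Measurable (counts (T := T)) :=
  measurable_pi_lambda _ fun A => (measurable_Mp_apply A.2.1).ennreal_toReal

/-- Each evaluation `M A` is the supremum of the finite counts of `A ∩ level T n`, so real-valued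
counts already generate the σ-algebra. This brings characteristic functions on finite-dimensional
spaces within reach. -/
theorem instMeasurableSpace_le_comap_counts :
    (inferInstance : MeasurableSpace (Mp T)) ≤ MeasurableSpace.comap counts inferInstance := by
  have h : @Measurable (Mp T) (Mp T) (MeasurableSpace.comap counts inferInstance) _ id := by
    refine @measurable_Mp_of_measurable_apply T _ _ (Mp T)
      (MeasurableSpace.comap counts inferInstance) id fun A hA => ?_
    simp_rw [apply_eq_iSup_level (id _ : Mp T).1 A]
    refine Measurable.iSup fun n => ?_
    have hn : (fun M : Mp T => (id M).1 (A ∩ level T n)) = fun M => ENNReal.ofReal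
        (counts M ⟨A ∩ level T n, hA.inter (measurableSet_level n), n, Set.inter_subset_right⟩) := by
      funext M
      rw [counts, ENNReal.ofReal_toReal]
      · rfl
      · exact ((measure_mono Set.inter_subset_right).trans_lt (M.apply_level_lt_top n)).ne
    rw [hn]
    exact ENNReal.measurable_ofReal.comp
      ((measurable_pi_apply _).comp (comap_measurable counts))
  intro s hs
  exact h hs

theorem exists_simpleFunc_sum (J : Finset (LevelSet T)) (c : J → ℝ) :
    ∃ (g : SimpleFunc (C0 T) ℝ) (n : ℕ), Function.support g ⊆ level T n ∧
      ∀ M : Mp T, ∫ f, g f ∂M.1 = ∑ j : J, counts M j.1 * c j := by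
  classical
  choose N hN using fun A : LevelSet T => A.2.2
  have hind : ∀ A : LevelSet T, A.1 ⊆ level T (J.sup N) ∨ A ∉ J := fun A => by
    by_cases hA : A ∈ J
    · exact Or.inl ((hN A).trans (monotone_level (Finset.le_sup hA)))
    · exact Or.inr hA
  have key : ∀ I : Finset J, ∃ g : SimpleFunc (C0 T) ℝ,
      Function.support g ⊆ level T (J.sup N) ∧
      ∀ M : Mp T, ∫ f, g f ∂M.1 = ∑ j ∈ I, counts M j.1 * c j := by
    intro I
    induction I using Finset.induction_on with
    | empty => exact ⟨0, by simp, by simp⟩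
    | insert j I hj ih =>
      obtain ⟨g, hg, hint⟩ := ih
      have hsub : j.1.1 ⊆ level T (J.sup N) :=
        (hN j.1).trans (monotone_level (Finset.le_sup j.2))
      have hs : Function.support ((SimpleFunc.const (C0 T) (c j)).restrict j.1.1) ⊆
          level T (J.sup N) := by
        rw [SimpleFunc.coe_restrict _ j.1.2.1]
        exact Set.support_indicator_subset.trans hsub
      refine ⟨(SimpleFunc.const (C0 T) (c j)).restrict j.1.1 + g, ?_, fun M => ?_⟩
      · rw [SimpleFunc.coe_add]
        exact (Function.support_add _ _).trans (Set.union_subset hs hg)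
      · simp only [SimpleFunc.coe_add, Pi.add_apply]
        rw [integral_add (integrable_of_support_subset_level M hs)
          (integrable_of_support_subset_level M hg), hint M, Finset.sum_insert hj,
          SimpleFunc.coe_restrict _ j.1.2.1, integral_indicator j.1.2.1]
        simp [counts, Measure.real]
  obtain ⟨g, hg, h⟩ := key Finset.univ
  exact ⟨g, _, hg, h⟩

/-- A finite measure on the space of point measures is determined by its characteristic
functional on simple functions. -/
theorem measure_Mp_ext {ν ν' : Measure (Mp T)} [IsFiniteMeasure ν] [IsFiniteMeasure ν']
    (h : ∀ (g : SimpleFunc (C0 T) ℝ) (n : ℕ), Function.support g ⊆ level T n →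
      ∫ M, Complex.exp ((∫ f, g f ∂M.1 : ℝ) * Complex.I) ∂ν =
        ∫ M, Complex.exp ((∫ f, g f ∂M.1 : ℝ) * Complex.I) ∂ν') : ν = ν' := by
  classical
  have hmap : ν.map counts = ν'.map counts := by
    have h1 := isProjectiveLimit_map (X := fun A (M : Mp T) => counts M A) (P := ν)
      measurable_counts.aemeasurable
    have h2 := isProjectiveLimit_map (X := fun A (M : Mp T) => counts M A) (P := ν')
      measurable_counts.aemeasurable
    have hfin : (fun J : Finset (LevelSet T) => ν.map fun M => J.restrict fun A => counts M A) =
        fun J : Finset (LevelSet T) => ν'.map fun M => J.restrict fun A => counts M A := by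
      funext J
      have hJ : Measurable fun M : Mp T => J.restrict fun A => counts M A :=
        (Finset.measurable_restrict _).comp measurable_counts
      refine Measure.ext_of_charFunDual ?_
      ext L
      have hL : StronglyMeasurable fun v : J → ℝ => Complex.exp ((L v : ℝ) * Complex.I) :=
        (by fun_prop : Continuous fun v : J → ℝ =>
          Complex.exp ((L v : ℝ) * Complex.I)).stronglyMeasurable
      rw [charFunDual_apply, charFunDual_apply,
        integral_map hJ.aemeasurable hL.aestronglyMeasurable,
        integral_map hJ.aemeasurable hL.aestronglyMeasurable]
      -- The coefficients are the values of `L` on the standard basis, so `L` applied to the counts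
      -- becomes the integral of one simple function.
      obtain ⟨g, n, hg, hint⟩ := exists_simpleFunc_sum J
        fun j => L fun i => if j = i then 1 else 0
      have hLe : ∀ M : Mp T, L (J.restrict fun A => counts M A) = ∫ f, g f ∂M.1 := by
        intro M
        rw [hint]
        exact LinearMap.pi_apply_eq_sum_univ L.toLinearMap _
      simp_rw [hLe]
      exact h g n hg
    rw [hfin] at h1
    exact h1.unique h2
  ext s hs
  obtain ⟨s', hs', rfl⟩ := instMeasurableSpace_le_comap_counts s hs
  rw [← Measure.map_apply measurable_counts hs', hmap, Measure.map_apply measurable_counts hs']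

/-! ### Poisson random measures -/

variable {Ω : Type*} [MeasurableSpace Ω] {P : Measure Ω} {μ : Measure (C0 T)} {Φ : Ω → Mp T}

theorem IsPoissonRandomMeasure.integral_exp_count (hΦ : IsPoissonRandomMeasure P μ Φ)
    {A : Set (C0 T)} (hA : MeasurableSet A) (hμA : μ A ≠ ∞) (c : ℝ) :
    ∫ ω, Complex.exp ((((Φ ω).1 A).toReal * c : ℝ) * Complex.I) ∂P =
      Complex.exp ((μ A).toReal * (Complex.exp (c * Complex.I) - 1)) := by
  have hm : Measurable fun x : ℝ≥0∞ => Complex.exp ((x.toReal * c : ℝ) * Complex.I) := by fun_prop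
  have h1 := integral_map (μ := P) ((measurable_Mp_apply hA).comp hΦ.measurable).aemeasurable
    hm.aestronglyMeasurable
  simp only [Function.comp_def] at h1
  rw [← h1, hΦ.law_of_finite A hA hμA, integral_map .of_discrete hm.aestronglyMeasurable]
  have h2 := charFun_map_cast_poissonMeasure (μ A).toNNReal c
  rw [charFun_apply, integral_map .of_discrete (by fun_prop)] at h2
  simpa [mul_comm, ENNReal.coe_toNNReal_eq_toReal] using h2

/-- The fibres of `g` over distinct values are disjoint, so the integral is a linear combination of
independent Poisson counts and the expectation factorises. -/
theorem IsPoissonRandomMeasure.integral_exp (hΦ : IsPoissonRandomMeasure P μ Φ)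
    {n : ℕ} (hμ : μ (level T n) < ∞) {g : SimpleFunc (C0 T) ℝ}
    (hg : Function.support g ⊆ level T n) :
    ∫ ω, Complex.exp ((∫ f, g f ∂(Φ ω).1 : ℝ) * Complex.I) ∂P =
      Complex.exp (∫ f, (Complex.exp ((g f : ℝ) * Complex.I) - 1) ∂μ) := by
  -- The value `0` is dropped: its fibre may have infinite intensity, and it contributes nothing to
  -- either side.
  let R := g.range.filter (· ≠ 0)
  have hfib : ∀ c : ℝ, c ≠ 0 → μ (g ⁻¹' {c}) < ∞ := fun c hc =>
    (measure_mono fun f (hf : g f = c) => hg (by rw [Function.mem_support, hf]; exact hc)).trans_lt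
      hμ
  have hgint : Integrable g μ := SimpleFunc.integrable_iff.2 hfib
  have hR : ∀ c : R, c.1 ≠ 0 := fun c => (Finset.mem_filter.1 c.2).2
  have hind : iIndepFun (fun (c : R) ω => (Φ ω).1 (g ⁻¹' {c.1})) P := by
    have h := hΦ.indep (Fintype.card R) (fun i => g ⁻¹' {((Fintype.equivFin R).symm i).1})
      (fun i => g.measurableSet_fiber _) fun i j hij => by
        refine Disjoint.preimage _ (Set.disjoint_singleton.2 fun h => hij ?_)
        exact (Fintype.equivFin R).symm.injective (Subtype.ext h)
    simpa using h.precomp (Fintype.equivFin R).injective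
  have hm : ∀ c : R, Measurable fun x : ℝ≥0∞ =>
      Complex.exp ((x.toReal * c.1 : ℝ) * Complex.I) := fun c => by fun_prop
  calc ∫ ω, Complex.exp ((∫ f, g f ∂(Φ ω).1 : ℝ) * Complex.I) ∂P
      = ∫ ω, ∏ c : R, Complex.exp ((((Φ ω).1 (g ⁻¹' {c.1})).toReal * c.1 : ℝ) * Complex.I) ∂P := by
        refine integral_congr_ae (Filter.Eventually.of_forall fun ω => ?_)
        simp only
        rw [integral_simpleFunc_eq_sum _ hg, Complex.ofReal_sum, Finset.sum_mul, Complex.exp_sum]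
    _ = ∏ c : R, Complex.exp ((μ (g ⁻¹' {c.1})).toReal * (Complex.exp (c.1 * Complex.I) - 1)) := by
        rw [hind.integral_fun_prod_comp
          (f := fun c x => Complex.exp ((x.toReal * c.1 : ℝ) * Complex.I))
          (fun c => ((measurable_Mp_apply (g.measurableSet_fiber c.1)).comp
            hΦ.measurable).aemeasurable) fun c => (hm c).aestronglyMeasurable]
        exact Finset.prod_congr rfl fun c _ => hΦ.integral_exp_count (g.measurableSet_fiber _)
          (hfib _ (hR c)).ne _
    _ = _ := by
        rw [← Complex.exp_sum]
        congr 1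
        have hmap := SimpleFunc.map_integral g (fun x : ℝ => Complex.exp (x * Complex.I) - 1)
          hgint (by simp)
        rw [SimpleFunc.integral_eq_integral _ (SimpleFunc.integrable_iff.2 fun y hy => ?_)] at hmap
        · simp only [SimpleFunc.coe_map, Function.comp_apply] at hmap
          rw [hmap, Finset.sum_coe_sort R (fun c : ℝ =>
            ((μ (g ⁻¹' {c})).toReal : ℂ) * (Complex.exp (c * Complex.I) - 1)), Finset.sum_filter]
          refine Finset.sum_congr rfl fun c _ => ?_
          by_cases hc : c = 0
          · simp [hc]
          · rw [if_pos hc, Complex.real_smul]; rfl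
        · refine (measure_mono ?_).trans_lt hμ
          intro f hf
          refine hg fun h0 => hy ?_
          rw [← (show _ = y from hf)]
          simp [h0]

/-- The probability that a Poisson variable of mean `r` is `m`, divided by `r ^ m`. -/
def poissonWeight (r : ℝ) (m : ℕ) : ℝ≥0∞ := ENNReal.ofReal (Real.exp (-r) / m.factorial)

/-- The law of the superposition of an independent mixed sample of a Poisson number of points in
`E` and of the restriction of `Φ` to the complement of `E`. -/
def splitLaw (P : Measure Ω) (μ : Measure (C0 T)) (Φ : Ω → Mp T) (E : Set (C0 T)) :
    Measure (Mp T) :=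
  Measure.sum fun m => poissonWeight (μ E).toReal m •
    ((Measure.pi fun _ : Fin m => μ.restrict E).prod P).map
      fun p => sumDirac p.1 + (Φ p.2).restrict Eᶜ

theorem measurable_sumDirac_add_restrict (hΦ : Measurable Φ) {E : Set (C0 T)}
    (hE : MeasurableSet E) (m : ℕ) :
    Measurable fun p : (Fin m → C0 T) × Ω => sumDirac p.1 + (Φ p.2).restrict Eᶜ :=
  measurable_add_Mp.comp (((measurable_sumDirac m).comp measurable_fst).prodMk
    ((measurable_restrict_Mp hE.compl).comp (hΦ.comp measurable_snd)))

theorem isProbabilityMeasure_splitLaw [IsProbabilityMeasure P] (hΦ : Measurable Φ)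
    {E : Set (C0 T)} (hE : MeasurableSet E) (hμE : μ E ≠ ∞) :
    IsProbabilityMeasure (splitLaw P μ Φ E) := by
  have : IsFiniteMeasure (μ.restrict E) := ⟨by simpa using hμE.lt_top⟩
  refine ⟨?_⟩
  have hterm : ∀ m : ℕ, poissonWeight (μ E).toReal m * (μ E) ^ m =
      ENNReal.ofReal (Real.exp (-(μ E).toReal) * (μ E).toReal ^ m / m.factorial) := by
    intro m
    rw [poissonWeight]
    conv_lhs => rw [← ENNReal.ofReal_toReal hμE]
    rw [← ENNReal.ofReal_pow ENNReal.toReal_nonneg, ← ENNReal.ofReal_mul (by positivity),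
      ENNReal.toReal_ofReal ENNReal.toReal_nonneg]
    congr 1
    ring
  have hsum := hasSum_one_poissonMeasure (μ E).toNNReal
  rw [splitLaw, Measure.sum_apply _ MeasurableSet.univ]
  calc _ = ∑' m : ℕ, poissonWeight (μ E).toReal m * (μ E) ^ m := by
        refine tsum_congr fun m => ?_
        rw [Measure.smul_apply, Measure.map_apply (measurable_sumDirac_add_restrict hΦ hE m)
          MeasurableSet.univ, Set.preimage_univ, ← Set.univ_prod_univ, Measure.prod_prod,
          Measure.pi_univ]
        simp
    _ = ENNReal.ofReal 1 := by
        simp_rw [hterm]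
        rw [← hsum.tsum_eq, ENNReal.ofReal_tsum_of_nonneg (fun m => by positivity) hsum.summable]
        rfl
    _ = 1 := ENNReal.ofReal_one

theorem integral_sumDirac_add_restrict {n : ℕ} {g : SimpleFunc (C0 T) ℝ}
    (hg : Function.support g ⊆ level T n) {E : Set (C0 T)} (hE : MeasurableSet E) {m : ℕ}
    (y : Fin m → C0 T) (M : Mp T) :
    ∫ f, g f ∂(sumDirac y + M.restrict Eᶜ).1 = ∑ i, g (y i) + ∫ f, g.restrict Eᶜ f ∂M.1 := by
  rw [Mp.coe_add, integral_add_measure (integrable_of_support_subset_level _ hg)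
    (integrable_of_support_subset_level _ hg), coe_sumDirac, integral_finsetSum_measure,
    Mp.coe_restrict, SimpleFunc.coe_restrict _ hE.compl, integral_indicator hE.compl]
  · simp
  · exact fun i _ => integrable_dirac (by simp)

/-- Compare characteristic functionals. The `m`-th component gives `exp (-μ E) * w * z ^ m / m!`,
where `z` comes from one point in `E` and `w` from `Φ` outside `E`. The exponential series sums
these to `exp (z - μ E) * w`, which is the functional of `Φ` with its exponent split over `E` and
`Eᶜ`. -/
theorem IsPoissonRandomMeasure.map_eq_splitLaw [IsProbabilityMeasure P]
    (hΦ : IsPoissonRandomMeasure P μ Φ) (hμ : ∀ n, μ (level T n) < ∞)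
    {E : Set (C0 T)} (hE : MeasurableSet E) (hμE : μ E ≠ ∞) :
    P.map Φ = splitLaw P μ Φ E := by
  have : IsFiniteMeasure (μ.restrict E) := ⟨by simpa using hμE.lt_top⟩
  have := isProbabilityMeasure_splitLaw (P := P) hΦ.measurable hE hμE
  have := Measure.isProbabilityMeasure_map (μ := P) hΦ.measurable.aemeasurable
  refine measure_Mp_ext fun g n hg => ?_
  have hmeas := measurable_exp_integral hg
  have hg' : Function.support (g.restrict Eᶜ) ⊆ level T n := by
    rw [SimpleFunc.coe_restrict _ hE.compl, Set.support_indicator]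
    exact Set.inter_subset_right.trans hg
  have hint : Integrable (fun M : Mp T => Complex.exp ((∫ f, g f ∂M.1 : ℝ) * Complex.I))
      (splitLaw P μ Φ E) :=
    Integrable.of_bound hmeas.aestronglyMeasurable 1 (Filter.Eventually.of_forall fun M => by
      rw [Complex.norm_exp_ofReal_mul_I])
  rw [integral_map hΦ.measurable.aemeasurable hmeas.aestronglyMeasurable,
    hΦ.integral_exp (hμ n) hg]
  rw [splitLaw] at hint ⊢
  refine ((hasSum_integral_measure hint).unique ?_).symm
  let z : ℂ := ∫ f in E, Complex.exp ((g f : ℝ) * Complex.I) ∂μ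
  let w : ℂ := Complex.exp (∫ f, (Complex.exp ((g.restrict Eᶜ f : ℝ) * Complex.I) - 1) ∂μ)
  have hterm : ∀ m : ℕ, ∫ M, Complex.exp ((∫ f, g f ∂M.1 : ℝ) * Complex.I)
      ∂(poissonWeight (μ E).toReal m • ((Measure.pi fun _ : Fin m => μ.restrict E).prod P).map
        fun p => sumDirac p.1 + (Φ p.2).restrict Eᶜ) =
      Complex.exp (-(μ E).toReal) * w * (z ^ m / m.factorial) := by
    intro m
    rw [integral_smul_measure, integral_map
      (measurable_sumDirac_add_restrict hΦ.measurable hE m).aemeasurable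
      hmeas.aestronglyMeasurable]
    simp_rw [integral_sumDirac_add_restrict hg hE, Complex.ofReal_add, add_mul, Complex.exp_add,
      Complex.ofReal_sum, Finset.sum_mul, Complex.exp_sum]
    rw [integral_prod_mul (fun y : Fin m → C0 T => ∏ i, Complex.exp ((g (y i) : ℝ) * Complex.I))
      (fun ω => Complex.exp ((∫ f, g.restrict Eᶜ f ∂(Φ ω).1 : ℝ) * Complex.I)),
      integral_fintype_prod_eq_pow (fun f : C0 T => Complex.exp ((g f : ℝ) * Complex.I)),
      hΦ.integral_exp (hμ n) hg', poissonWeight, ENNReal.toReal_ofReal (by positivity),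
      Complex.real_smul, Fintype.card_fin]
    simp only [Complex.ofReal_div, Complex.ofReal_exp, Complex.ofReal_neg, Complex.ofReal_natCast]
    ring
  simp_rw [hterm]
  have hexp := (NormedSpace.expSeries_div_hasSum_exp z).mul_left
    (Complex.exp (-(μ E).toReal) * w)
  rw [← Complex.exp_eq_exp_ℂ] at hexp
  have hI : Integrable (fun f => Complex.exp ((g f : ℝ) * Complex.I) - 1) μ := by
    refine (SimpleFunc.integrable_iff (f := g.map fun x : ℝ =>
      Complex.exp (x * Complex.I) - 1)).2 fun y hy => ?_
    refine (measure_mono fun f hf => hg fun h0 => hy ?_).trans_lt (hμ n)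
    rw [← (show _ = y from hf)]
    simp [h0]
  have hcompl : ∫ f, (Complex.exp ((g.restrict Eᶜ f : ℝ) * Complex.I) - 1) ∂μ =
      ∫ f in Eᶜ, (Complex.exp ((g f : ℝ) * Complex.I) - 1) ∂μ := by
    rw [← integral_indicator hE.compl]
    refine integral_congr_ae (Filter.Eventually.of_forall fun f => ?_)
    simp only [SimpleFunc.coe_restrict _ hE.compl]
    by_cases hf : f ∈ Eᶜ
    · simp only [Set.indicator_of_mem hf]
    · simp only [Set.indicator_of_notMem hf]; simp
  have hEint : ∫ f in E, (Complex.exp ((g f : ℝ) * Complex.I) - 1) ∂μ = z - (μ E).toReal := by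
    rw [integral_sub]
    · simp [z, Measure.real]
    · refine Integrable.of_bound ?_ 1 (Filter.Eventually.of_forall fun f => ?_)
      · exact (Complex.measurable_exp.comp ((Complex.measurable_ofReal.comp
          g.measurable).mul_const _)).aestronglyMeasurable
      · rw [Complex.norm_exp_ofReal_mul_I]
    · exact integrable_const _
  have hval : Complex.exp (∫ f, (Complex.exp ((g f : ℝ) * Complex.I) - 1) ∂μ) =
      Complex.exp (-(μ E).toReal) * w * Complex.exp z := by
    rw [← Complex.exp_add, ← Complex.exp_add, hcompl, ← integral_add_compl hE hI, hEint]
    congr 1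
    ring
  rw [hval]
  exact hexp

/-! ### Subfamilies of a finite family of points -/

/-- `∑_{i ∈ S} δ_{y i}`. -/
def sumDiracOn {N : ℕ} (S : Finset (Fin N)) (y : Fin N → C0 T) : Mp T :=
  ⟨∑ i ∈ S, Measure.dirac (y i), S, inferInstance, fun i => y i, fun _ _ => Set.toFinite _, by
    rw [Measure.sum_fintype, Finset.sum_coe_sort S fun i => Measure.dirac (y i)]⟩

theorem coe_sumDiracOn {N : ℕ} (S : Finset (Fin N)) (y : Fin N → C0 T) :
    (sumDiracOn S y).1 = ∑ i ∈ S, Measure.dirac (y i) := rfl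

theorem measurable_sumDiracOn {N : ℕ} (S : Finset (Fin N)) :
    Measurable (sumDiracOn S : (Fin N → C0 T) → Mp T) := by
  refine measurable_Mp_of_measurable_apply fun A hA => ?_
  simp only [coe_sumDiracOn, Measure.coe_finsetSum, Finset.sum_apply]
  exact Finset.measurable_sum _ fun i _ =>
    ((Measure.measurable_coe hA).comp Measure.measurable_dirac).comp (measurable_pi_apply i)

theorem atoms_sumDiracOn {N : ℕ} (S : Finset (Fin N)) (y : Fin N → C0 T) :
    atoms (sumDiracOn S y) = y '' S := by
  ext g
  simp only [atoms, coe_sumDiracOn, Set.mem_ofPred_eq, Measure.coe_finsetSum, Finset.sum_apply,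
    ne_eq, Finset.sum_eq_zero_iff, not_forall, Set.mem_image,
    Measure.dirac_apply, Set.indicator_apply_eq_zero, Set.mem_singleton_iff]
  simp

theorem sumDiracOn_apply_univ {N : ℕ} (S : Finset (Fin N)) (y : Fin N → C0 T) :
    (sumDiracOn S y).1 Set.univ = S.card := by
  simp [coe_sumDiracOn]

theorem sumDiracOn_add_compl {N : ℕ} (S : Finset (Fin N)) (y : Fin N → C0 T) :
    sumDiracOn S y + sumDiracOn Sᶜ y = sumDirac y :=
  Subtype.ext (Finset.sum_add_sum_compl S fun i => Measure.dirac (y i))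

theorem restrict_sumDirac {N : ℕ} (y : Fin N → C0 T) (X : Set (C0 T)) (S : Finset (Fin N))
    (hS : ∀ i, i ∈ S ↔ y i ∈ X) : (sumDirac y).restrict X = sumDiracOn S y := by
  rw [← sumDiracOn_add_compl S, Mp.restrict_add, Mp.restrict_eq_self, Mp.restrict_eq_zero,
    Mp.add_zero']
  · rw [atoms_sumDiracOn, Set.disjoint_left]
    rintro _ ⟨i, hi, rfl⟩ hX
    exact Finset.mem_compl.1 hi ((hS i).2 hX)
  · rw [atoms_sumDiracOn]
    rintro _ ⟨i, hi, rfl⟩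
    exact (hS i).1 hi

/-- The point measures with exactly `k` extremal points, all of them in `E`, whose extremal and
sub-extremal parts are in `A` and `B`. -/
def extremalEvent (K : Set T) (A B : Set (Mp T)) (k : ℕ) (E : Set (C0 T)) : Set (Mp T) :=
  {M | extremalPart K M ∈ A ∧ subExtremalPart K M ∈ B ∧ (extremalPart K M).1 Set.univ = k ∧
    (extremalPart K M).1 Eᶜ = 0}

/-- The pairs `(M, N)` of a measure `M ∈ A` and a measure `N ∈ B` that are the extremal and
sub-extremal parts of their sum. -/
def splitEvent (K : Set T) (A B : Set (Mp T)) : Set (Mp T × Mp T) :=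
  {p | p.1 ∈ A ∩ CPlus K ∧ p.2 ∈ B ∩ CMinus K (maxFun p.1)}

/-- The second conclusion recovers `S` from the total measure as the set of indices of extremal
points. It gives uniqueness of the splitting, even when some `y i` coincide. -/
theorem mem_extremalEvent_of_splitEvent {A B : Set (Mp T)} {E : Set (C0 T)} {N : ℕ}
    {y : Fin N → C0 T} (hy : ∀ i, y i ∈ E) {M : Mp T} {S : Finset (Fin N)}
    (h : (sumDiracOn S y, sumDiracOn Sᶜ y + M) ∈ splitEvent K A B) :
    sumDirac y + M ∈ extremalEvent K A B S.card E ∧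
      ∀ i, i ∈ S ↔ ¬ LtOn K (y i).1 (maxFun (sumDirac y + M)) := by
  obtain ⟨⟨hA, hP⟩, hB, hM⟩ := h
  simp only at hA hP hB hM
  have hdec : sumDirac y + M = sumDiracOn S y + (sumDiracOn Sᶜ y + M) := by
    rw [← sumDiracOn_add_compl S, Mp.add_assoc']
  have hext := extremalPart_add hP hM
  have hsub := subExtremalPart_add hP hM
  rw [← hdec] at hext hsub
  refine ⟨⟨by rwa [hext], by rwa [hsub], by rw [hext, sumDiracOn_apply_univ], ?_⟩, fun i => ?_⟩
  · rw [hext, Mp.apply_eq_zero_iff, atoms_sumDiracOn]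
    rintro f hf ⟨i, -, rfl⟩
    exact hf (hy i)
  · constructor
    · intro hi
      have : y i ∈ atoms (extremalPart K (sumDirac y + M)) := by
        rw [hext, atoms_sumDiracOn]; exact ⟨i, hi, rfl⟩
      rw [atoms_extremalPart] at this
      exact this.2
    · intro hlt
      by_contra hi
      have : y i ∈ atoms (subExtremalPart K (sumDirac y + M)) := by
        rw [hsub, atoms_add, atoms_sumDiracOn]
        exact Or.inl ⟨i, Finset.mem_coe.2 (Finset.mem_compl.2 hi), rfl⟩
      rw [atoms_subExtremalPart] at this
      exact hlt this.2

theorem exists_splitEvent_of_mem_extremalEvent {A B : Set (Mp T)} {E : Set (C0 T)} {N k : ℕ}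
    {y : Fin N → C0 T} {M : Mp T} (hM : atoms M ⊆ Eᶜ)
    (h : sumDirac y + M ∈ extremalEvent K A B k E) :
    ∃ S : Finset (Fin N), S.card = k ∧
      (sumDiracOn S y, sumDiracOn Sᶜ y + M) ∈ splitEvent K A B := by
  classical
  obtain ⟨hA, hB, hk, hE⟩ := h
  let S : Finset (Fin N) :=
    Finset.univ.filter fun i => ¬ LtOn K (y i).1 (maxFun (sumDirac y + M))
  -- The atoms of `M` lie outside `E` while the extremal ones lie in `E`, so every extremal point is
  -- among the `y i`.
  have hMlt : ∀ f ∈ atoms M, LtOn K f.1 (maxFun (sumDirac y + M)) := by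
    intro f hf
    by_contra hlt
    refine (Mp.apply_eq_zero_iff _ _).1 hE f (hM hf) ?_
    rw [atoms_extremalPart, atoms_add]
    exact ⟨Or.inr hf, hlt⟩
  have hext : extremalPart K (sumDirac y + M) = sumDiracOn S y := by
    rw [extremalPart, Mp.restrict_add, restrict_sumDirac y _ S (by simp [S]),
      Mp.restrict_eq_zero M, Mp.add_zero']
    rw [Set.disjoint_left]
    exact fun f hf h => h (hMlt f hf)
  have hsub : subExtremalPart K (sumDirac y + M) = sumDiracOn Sᶜ y + M := by
    rw [subExtremalPart, Mp.restrict_add, restrict_sumDirac y _ Sᶜ (by simp [S]),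
      Mp.restrict_eq_self M]
    exact hMlt
  refine ⟨S, ?_, ⟨⟨?_, ?_⟩, ?_, ?_⟩⟩
  · rw [hext, sumDiracOn_apply_univ] at hk
    exact_mod_cast hk
  · rwa [← hext]
  · rw [← hext]; exact extremalPart_mem_CPlus _
  · rwa [← hsub]
  · simp only [← hext, ← hsub]
    exact subExtremalPart_mem_CMinus _

theorem indicator_extremalEvent {A B : Set (Mp T)} {E : Set (C0 T)} {N : ℕ} (k : ℕ)
    {y : Fin N → C0 T} (hy : ∀ i, y i ∈ E) {M : Mp T} (hM : atoms M ⊆ Eᶜ) :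
    (extremalEvent K A B k E).indicator (1 : Mp T → ℝ≥0∞) (sumDirac y + M) =
      ∑ S ∈ Finset.powersetCard k (Finset.univ : Finset (Fin N)),
        (splitEvent K A B).indicator 1 (sumDiracOn S y, sumDiracOn Sᶜ y + M) := by
  by_cases h : sumDirac y + M ∈ extremalEvent K A B k E
  · obtain ⟨S, hSk, hS⟩ := exists_splitEvent_of_mem_extremalEvent hM h
    rw [Set.indicator_of_mem h, Finset.sum_eq_single S, Set.indicator_of_mem hS]
    · rfl
    · intro S' _ hne
      refine Set.indicator_of_notMem (fun hS' => hne ?_) _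
      ext i
      rw [(mem_extremalEvent_of_splitEvent hy hS).2, (mem_extremalEvent_of_splitEvent hy hS').2]
    · exact fun hS' => absurd (Finset.mem_powersetCard.2 ⟨Finset.subset_univ _, hSk⟩) hS'
  · rw [Set.indicator_of_notMem h, Finset.sum_eq_zero]
    intro S hS
    refine Set.indicator_of_notMem (fun hS' => h ?_) _
    rw [← (Finset.mem_powersetCard.1 hS).2]
    exact (mem_extremalEvent_of_splitEvent hy hS').1

theorem measurableSet_splitEvent (hK : IsClosed K) (hK' : K.Nonempty) {A B : Set (Mp T)}
    (hA : MeasurableSet A) (hB : MeasurableSet B) : MeasurableSet (splitEvent K A B) := by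
  have : splitEvent K A B = (Prod.fst ⁻¹' (A ∩ CPlus K) ∩ Prod.snd ⁻¹' B) ∩
      {p : Mp T × Mp T | p.2 ∈ CMinus K (maxFun p.1)} := by
    ext p
    simp only [splitEvent, Set.mem_ofPred_eq, Set.mem_inter_iff, Set.mem_preimage]
    tauto
  rw [this]
  exact ((measurable_fst (hA.inter (measurableSet_CPlus hK hK'))).inter
    (measurable_snd hB)).inter (measurableSet_mem_CMinus_maxFun hK hK')

theorem measurableSet_extremalEvent (hK : IsClosed K) (hK' : K.Nonempty) {A B : Set (Mp T)}
    (hA : MeasurableSet A) (hB : MeasurableSet B) (k : ℕ) {E : Set (C0 T)}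
    (hE : MeasurableSet E) : MeasurableSet (extremalEvent K A B k E) := by
  have hm := measurable_extremalPart (T := T) hK hK'
  exact (hm hA).inter ((measurable_subExtremalPart hK hK' hB).inter
    ((((measurable_Mp_apply MeasurableSet.univ).comp hm) (measurableSet_singleton (k : ℝ≥0∞))).inter
      (((measurable_Mp_apply hE.compl).comp hm) (measurableSet_singleton 0))))

/-! ### The decomposition at a fixed level -/

/-- Splitting a family of points along an equivalence of the index set preserves product
measures. -/
theorem measurePreserving_piSplit {α : Type*} [MeasurableSpace α] (ν : Measure α) [SigmaFinite ν]
    {k m N : ℕ} (e : Fin k ⊕ Fin m ≃ Fin N) :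
    MeasurePreserving (fun p : (Fin k → α) × (Fin m → α) => fun i => Sum.elim p.1 p.2 (e.symm i))
      ((Measure.pi fun _ : Fin k => ν).prod (Measure.pi fun _ : Fin m => ν))
      (Measure.pi fun _ : Fin N => ν) := by
  have h1 := measurePreserving_sumPiEquivProdPi_symm (ι := Fin k) (ι' := Fin m)
    (X := fun _ => α) fun _ => ν
  have h2 := measurePreserving_piCongrLeft (α := fun _ : Fin N => α) (fun _ => ν) e
  have h := h2.comp h1
  convert h using 1
  funext p i
  obtain ⟨j, rfl⟩ := e.surjective i
  rw [Function.comp_apply, MeasurableEquiv.coe_piCongrLeft, Equiv.piCongrLeft_apply_apply,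
    Equiv.symm_apply_apply]
  cases j <;> rfl

variable {Ω : Type*} [MeasurableSpace Ω] {P : Measure Ω} {μ : Measure (C0 T)} {Φ : Ω → Mp T}

/-- Enumerating `S` and `Sᶜ` in increasing order reindexes the product measure. The right-hand side
does not involve `S`, so all `k`-subsets contribute equally. -/
theorem measure_splitEvent_eq_lintegral [IsProbabilityMeasure P] (hΦ : Measurable Φ)
    (hK : IsClosed K) (hK' : K.Nonempty)
    {A B : Set (Mp T)} (hA : MeasurableSet A) (hB : MeasurableSet B) {E : Set (C0 T)}
    (hE : MeasurableSet E) (ν : Measure (C0 T)) [SigmaFinite ν] {k m : ℕ}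
    {S : Finset (Fin (k + m))} (hS : S.card = k) :
    ((Measure.pi fun _ : Fin (k + m) => ν).prod P)
        {p | (sumDiracOn S p.1, sumDiracOn Sᶜ p.1 + (Φ p.2).restrict Eᶜ) ∈ splitEvent K A B} =
      ∫⁻ a, ((Measure.pi fun _ : Fin m => ν).prod P)
        {q | (sumDirac a, sumDirac q.1 + (Φ q.2).restrict Eᶜ) ∈ splitEvent K A B}
        ∂(Measure.pi fun _ : Fin k => ν) := by
  have hSc : Sᶜ.card = m := by rw [Finset.card_compl, hS]; simp
  let e := finSumEquivOfFinset hS hSc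
  have hψ := ((measurePreserving_piSplit ν e).prod (MeasurePreserving.id P)).comp
    (measurePreserving_prodAssoc (Measure.pi fun _ : Fin k => ν)
      (Measure.pi fun _ : Fin m => ν) P).symm
  have hset : MeasurableSet {p : (Fin (k + m) → C0 T) × Ω |
      (sumDiracOn S p.1, sumDiracOn Sᶜ p.1 + (Φ p.2).restrict Eᶜ) ∈ splitEvent K A B} :=
    (((measurable_sumDiracOn S).comp measurable_fst).prodMk (measurable_add_Mp.comp
      (((measurable_sumDiracOn Sᶜ).comp measurable_fst).prodMk
        ((measurable_restrict_Mp hE.compl).comp (hΦ.comp measurable_snd)))))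
      (measurableSet_splitEvent hK hK' hA hB)
  have hset' := hψ.measurable hset
  rw [← hψ.measure_preimage hset.nullMeasurableSet, Measure.prod_apply hset']
  refine lintegral_congr fun a => ?_
  congr 1
  ext q
  have h1 : sumDiracOn S (fun i => Sum.elim a q.1 (e.symm i)) = sumDirac a := by
    refine Subtype.ext ?_
    rw [coe_sumDiracOn, coe_sumDirac, ← Finset.map_orderEmbOfFin_univ S hS, Finset.sum_map]
    refine Finset.sum_congr rfl fun i _ => ?_
    change Measure.dirac (Sum.elim a q.1 (e.symm (S.orderEmbOfFin hS i))) = _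
    rw [← finSumEquivOfFinset_inl hS hSc, Equiv.symm_apply_apply]
    rfl
  have h2 : sumDiracOn Sᶜ (fun i => Sum.elim a q.1 (e.symm i)) = sumDirac q.1 := by
    refine Subtype.ext ?_
    rw [coe_sumDiracOn, coe_sumDirac, ← Finset.map_orderEmbOfFin_univ Sᶜ hSc, Finset.sum_map]
    refine Finset.sum_congr rfl fun i _ => ?_
    change Measure.dirac (Sum.elim a q.1 (e.symm (Sᶜ.orderEmbOfFin hSc i))) = _
    rw [← finSumEquivOfFinset_inr hS hSc, Equiv.symm_apply_apply]
    rfl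
  change (sumDiracOn S (fun i => Sum.elim a q.1 (e.symm i)),
    sumDiracOn Sᶜ (fun i => Sum.elim a q.1 (e.symm i)) + (Φ q.2).restrict Eᶜ) ∈
      splitEvent K A B ↔ _
  rw [h1, h2]
  rfl

theorem poissonWeight_mul_choose (r : ℝ) (k m : ℕ) :
    poissonWeight r (k + m) * ((k + m).choose k : ℕ) =
      (k.factorial : ℝ≥0∞)⁻¹ * poissonWeight r m := by
  have hk : (0 : ℝ) < k.factorial := by positivity
  rw [poissonWeight, poissonWeight, ← ENNReal.ofReal_natCast, ← ENNReal.ofReal_natCast,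
    ← ENNReal.ofReal_inv_of_pos hk, ← ENNReal.ofReal_mul (by positivity),
    ← ENNReal.ofReal_mul (by positivity), Nat.cast_add_choose]
  congr 1
  field_simp

theorem measure_prod_extremalEvent [IsProbabilityMeasure P] (hΦ : Measurable Φ)
    (hK : IsClosed K) (hK' : K.Nonempty)
    {A B : Set (Mp T)} (hA : MeasurableSet A) (hB : MeasurableSet B) {E : Set (C0 T)}
    (hE : MeasurableSet E) (hμE : μ E ≠ ∞) (k N : ℕ) :
    ((Measure.pi fun _ : Fin N => μ.restrict E).prod P)
        {p | sumDirac p.1 + (Φ p.2).restrict Eᶜ ∈ extremalEvent K A B k E} =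
      ∑ S ∈ Finset.powersetCard k (Finset.univ : Finset (Fin N)),
        ((Measure.pi fun _ : Fin N => μ.restrict E).prod P)
        {p | (sumDiracOn S p.1, sumDiracOn Sᶜ p.1 + (Φ p.2).restrict Eᶜ) ∈
          splitEvent K A B} := by
  have : IsFiniteMeasure (μ.restrict E) := ⟨by simpa using hμE.lt_top⟩
  have hset : ∀ S : Finset (Fin N), MeasurableSet {p : (Fin N → C0 T) × Ω |
      (sumDiracOn S p.1, sumDiracOn Sᶜ p.1 + (Φ p.2).restrict Eᶜ) ∈ splitEvent K A B} := fun S =>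
    (((measurable_sumDiracOn S).comp measurable_fst).prodMk (measurable_add_Mp.comp
      (((measurable_sumDiracOn Sᶜ).comp measurable_fst).prodMk
        ((measurable_restrict_Mp hE.compl).comp (hΦ.comp measurable_snd)))))
      (measurableSet_splitEvent hK hK' hA hB)
  have hG : MeasurableSet {p : (Fin N → C0 T) × Ω |
      sumDirac p.1 + (Φ p.2).restrict Eᶜ ∈ extremalEvent K A B k E} :=
    measurable_sumDirac_add_restrict hΦ hE N (measurableSet_extremalEvent hK hK' hA hB k hE)
  have hae : ∀ᵐ p ∂((Measure.pi fun _ : Fin N => μ.restrict E).prod P), ∀ i, p.1 i ∈ E := by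
    have h1 : ∀ᵐ y ∂(Measure.pi fun _ : Fin N => μ.restrict E), ∀ i, y i ∈ E :=
      ae_all_iff.2 fun i => Measure.tendsto_eval_ae_ae.eventually (ae_restrict_mem hE)
    exact Measure.quasiMeasurePreserving_fst.ae h1
  rw [← lintegral_indicator_one hG]
  simp_rw [← lintegral_indicator_one (hset _)]
  rw [← lintegral_finsetSum _ fun S _ => measurable_one.indicator (hset S)]
  refine lintegral_congr_ae (hae.mono fun p hp => ?_)
  exact indicator_extremalEvent k hp (by rw [atoms_restrict]; exact Set.inter_subset_right)

theorem IsPoissonRandomMeasure.measure_extremalEvent [IsProbabilityMeasure P]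
    (hΦ : IsPoissonRandomMeasure P μ Φ) (hμ : ∀ n, μ (level T n) < ∞)
    (hK : IsClosed K) (hK' : K.Nonempty)
    {A B : Set (Mp T)} (hA : MeasurableSet A) (hB : MeasurableSet B) {E : Set (C0 T)}
    (hE : MeasurableSet E) (hμE : μ E ≠ ∞) (k : ℕ) :
    P (Φ ⁻¹' extremalEvent K A B k E) = (k.factorial : ℝ≥0∞)⁻¹ *
      ∫⁻ a, P {ω | (sumDirac a, Φ ω) ∈ splitEvent K A B}
        ∂(Measure.pi fun _ : Fin k => μ.restrict E) := by
  have : IsFiniteMeasure (μ.restrict E) := ⟨by simpa using hμE.lt_top⟩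
  have hG := measurableSet_extremalEvent hK hK' hA hB k hE
  have hsp := measurableSet_splitEvent hK hK' hA hB
  have hlaw := hΦ.map_eq_splitLaw hμ hE hμE
  have hlaw_apply : ∀ F : Set (Mp T), MeasurableSet F → P (Φ ⁻¹' F) =
      ∑' m, poissonWeight (μ E).toReal m * ((Measure.pi fun _ : Fin m => μ.restrict E).prod P)
        {p | sumDirac p.1 + (Φ p.2).restrict Eᶜ ∈ F} := by
    intro F hF
    rw [← Measure.map_apply hΦ.measurable hF, hlaw, splitLaw, Measure.sum_apply _ hF]
    refine tsum_congr fun m => ?_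
    rw [Measure.smul_apply, Measure.map_apply
      (measurable_sumDirac_add_restrict hΦ.measurable hE m) hF]
    rfl
  let Q : ℕ → (Fin k → C0 T) → ℝ≥0∞ := fun m a =>
    ((Measure.pi fun _ : Fin m => μ.restrict E).prod P)
      {q | (sumDirac a, sumDirac q.1 + (Φ q.2).restrict Eᶜ) ∈ splitEvent K A B}
  have hQ : ∀ m, Measurable (Q m) := by
    intro m
    refine measurable_measure_prodMk_left (s := {p : (Fin k → C0 T) × (Fin m → C0 T) × Ω |
      (sumDirac p.1, sumDirac p.2.1 + (Φ p.2.2).restrict Eᶜ) ∈ splitEvent K A B}) ?_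
    exact (((measurable_sumDirac k).comp measurable_fst).prodMk
      ((measurable_sumDirac_add_restrict hΦ.measurable hE m).comp measurable_snd)) hsp
  -- Put `N = k + m`: the terms with `N < k` vanish because there is no `k`-subset of `Fin N`.
  rw [hlaw_apply _ hG, ← (add_right_injective k).tsum_eq]
  · calc _ = ∑' m, (k.factorial : ℝ≥0∞)⁻¹ * (poissonWeight (μ E).toReal m *
          ∫⁻ a, Q m a ∂(Measure.pi fun _ : Fin k => μ.restrict E)) := by
          refine tsum_congr fun m => ?_
          rw [measure_prod_extremalEvent hΦ.measurable hK hK' hA hB hE hμE,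
            Finset.sum_congr rfl fun S hS => measure_splitEvent_eq_lintegral hΦ.measurable
              hK hK' hA hB hE (μ.restrict E) (Finset.mem_powersetCard.1 hS).2,
            Finset.sum_const, Finset.card_powersetCard, Finset.card_univ, Fintype.card_fin,
            nsmul_eq_mul, ← mul_assoc, poissonWeight_mul_choose, mul_assoc]
      _ = (k.factorial : ℝ≥0∞)⁻¹ * ∫⁻ a, ∑' m, poissonWeight (μ E).toReal m * Q m a
          ∂(Measure.pi fun _ : Fin k => μ.restrict E) := by
          rw [ENNReal.tsum_mul_left, lintegral_tsum fun m => ((hQ m).const_mul _).aemeasurable]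
          simp_rw [lintegral_const_mul _ (hQ _)]
      _ = _ := by
          congr 1
          refine lintegral_congr fun a => ?_
          -- With `a` fixed, the splitting of the law is read backwards: the sum over the `m`
          -- remaining points in `E` is a probability for `Φ` itself.
          exact (hlaw_apply {M | (sumDirac a, M) ∈ splitEvent K A B}
            (measurable_prodMk_left hsp)).symm
  · intro N hN
    by_contra hlt
    refine hN ?_
    have hNk : N < k := by
      by_contra h
      exact hlt ⟨N - k, by simp only; omega⟩
    simp only
    rw [measure_prod_extremalEvent hΦ.measurable hK hK' hA hB hE hμE,
      Finset.powersetCard_eq_empty.2 (by simpa using hNk), Finset.sum_empty, mul_zero]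

/-! ### Exhaustion by level sets -/

/-- The masses outside the levels decrease to `0`, and a point measure gives no set a mass strictly
between `0` and `1`. -/
theorem Mp.exists_apply_compl_level_eq_zero (M : Mp T) (hM : M.1 Set.univ ≠ ∞) :
    ∃ n, M.1 (level T n)ᶜ = 0 := by
  have : IsFiniteMeasure M.1 := ⟨hM.lt_top⟩
  have hanti : Antitone fun n => (level T n)ᶜ := fun _ _ h =>
    Set.compl_subset_compl.2 (monotone_level h)
  have hlim := tendsto_measure_iInter_atTop (μ := M.1)
    (fun n => (measurableSet_level (T := T) n).compl.nullMeasurableSet) hanti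
    ⟨0, measure_ne_top _ _⟩
  rw [← Set.compl_iUnion, iUnion_level, Set.compl_univ, measure_empty] at hlim
  obtain ⟨n, hn⟩ := (hlim.eventually (gt_mem_nhds one_pos)).exists
  refine ⟨n, ?_⟩
  by_contra h
  exact absurd (M.one_le_apply h) (not_le.2 hn)

theorem IsPoissonRandomMeasure.measure_extremal_card_eq [IsProbabilityMeasure P]
    (hΦ : IsPoissonRandomMeasure P μ Φ) (hμ : ∀ n, μ (level T n) < ∞)
    (hK : IsClosed K) (hK' : K.Nonempty)
    {A B : Set (Mp T)} (hA : MeasurableSet A) (hB : MeasurableSet B) (k : ℕ) :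
    P {ω | extremalPart K (Φ ω) ∈ A ∧ subExtremalPart K (Φ ω) ∈ B ∧
        (extremalPart K (Φ ω)).1 Set.univ = k} = (k.factorial : ℝ≥0∞)⁻¹ *
      ∫⁻ a, P {ω | (sumDirac a, Φ ω) ∈ splitEvent K A B} ∂(Measure.pi fun _ : Fin k => μ) := by
  have : SigmaFinite μ := ⟨⟨⟨level T, fun _ => trivial, hμ, iUnion_level⟩⟩⟩
  let H : (Fin k → C0 T) → ℝ≥0∞ := fun a => P {ω | (sumDirac a, Φ ω) ∈ splitEvent K A B}
  have hunion : {ω | extremalPart K (Φ ω) ∈ A ∧ subExtremalPart K (Φ ω) ∈ B ∧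
      (extremalPart K (Φ ω)).1 Set.univ = k} = ⋃ n, Φ ⁻¹' extremalEvent K A B k (level T n) := by
    ext ω
    simp only [Set.mem_iUnion, Set.mem_preimage, extremalEvent, Set.mem_ofPred_eq]
    constructor
    · rintro ⟨h1, h2, h3⟩
      obtain ⟨n, hn⟩ := (extremalPart K (Φ ω)).exists_apply_compl_level_eq_zero
        (by rw [h3]; exact ENNReal.natCast_ne_top k)
      exact ⟨n, h1, h2, h3, hn⟩
    · rintro ⟨n, h1, h2, h3, -⟩
      exact ⟨h1, h2, h3⟩
  have hmono : Monotone fun n => Φ ⁻¹' extremalEvent K A B k (level T n) :=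
    fun m n h ω hω => ⟨hω.1, hω.2.1, hω.2.2.1,
      measure_mono_null (Set.compl_subset_compl.2 (monotone_level h)) hω.2.2.2⟩
  have hpi : Monotone fun n => Set.univ.pi fun _ : Fin k => level T n :=
    fun m n h => Set.pi_mono fun _ _ => monotone_level h
  have hpiU : ⋃ n, (Set.univ.pi fun _ : Fin k => level T n) = Set.univ := by
    refine Set.eq_univ_of_forall fun a => ?_
    have hex : ∀ i, ∃ n, a i ∈ level T n := fun i =>
      Set.mem_iUnion.1 (by rw [iUnion_level]; trivial)
    choose N hN using hex
    exact Set.mem_iUnion.2 ⟨Finset.univ.sup N, fun i _ =>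
      monotone_level (Finset.le_sup (Finset.mem_univ i)) (hN i)⟩
  rw [hunion, hmono.measure_iUnion]
  change _ = _ * ∫⁻ a, H a ∂(Measure.pi fun _ : Fin k => μ)
  -- Seen as a measure with density `H`, the integral over the increasing boxes `level T n ^ k`
  -- converges by continuity from below.
  rw [← setLIntegral_univ, ← withDensity_apply _ MeasurableSet.univ, ← hpiU, hpi.measure_iUnion,
    ENNReal.mul_iSup]
  refine iSup_congr fun n => ?_
  rw [hΦ.measure_extremalEvent hμ hK hK' hA hB (measurableSet_level n) (hμ n).ne k,
    withDensity_apply _ (MeasurableSet.univ_pi fun _ => measurableSet_level n),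
    Measure.restrict_pi_pi]

theorem IsPoissonRandomMeasure.measure_eq_zero (hΦ : IsPoissonRandomMeasure P μ Φ) :
    P {ω | Φ ω = 0} = EReal.exp (-(μ Set.univ : EReal)) := by
  have hset : {ω | Φ ω = 0} = (fun ω => (Φ ω).1 Set.univ) ⁻¹' {0} := by
    ext ω
    simp only [Set.mem_ofPred_eq, Set.mem_preimage, Set.mem_singleton_iff,
      Measure.measure_univ_eq_zero]
    exact Subtype.ext_iff
  rw [hset]
  by_cases h : μ Set.univ = ∞
  · have hae := hΦ.law_of_infinite Set.univ MeasurableSet.univ h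
    rw [h]
    simp only [EReal.coe_ennreal_top, EReal.neg_top, EReal.exp_bot]
    have hsub : (fun ω => (Φ ω).1 Set.univ) ⁻¹' {0} ⊆ {ω | ¬ (Φ ω).1 Set.univ = ∞} :=
      fun ω hω htop =>
        ENNReal.zero_ne_top ((show (Φ ω).1 Set.univ = 0 from hω).symm.trans htop)
    exact measure_mono_null hsub (ae_iff.1 hae)
  · have hm : Measurable fun ω => (Φ ω).1 Set.univ :=
      (measurable_Mp_apply MeasurableSet.univ).comp hΦ.measurable
    rw [← Measure.map_apply hm (measurableSet_singleton 0), hΦ.law_of_finite _ MeasurableSet.univ h,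
      Measure.map_apply .of_discrete (measurableSet_singleton 0)]
    have hpre : (fun n : ℕ => (n : ℝ≥0∞)) ⁻¹' {0} = {0} := by ext n; simp
    rw [hpre, poissonMeasure_singleton]
    lift μ Set.univ to ℝ≥0 using h with r
    simp only [ENNReal.toNNReal_coe, pow_zero, mul_one, Nat.factorial_zero, Nat.cast_one, div_one]
    rw [show (((r : ℝ≥0∞) : EReal)) = ((r : ℝ) : EReal) from rfl, ← EReal.coe_neg, EReal.exp_coe]

end

end MaxID

/-! ### The null case and the case of `k` extremal points -/

open MaxID

theorem theorem2p1 {T : Type*} [MetricSpace T] [CompactSpace T]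
    {Ω : Type*} [MeasurableSpace Ω] (P : Measure Ω) [IsProbabilityMeasure P]
    (μ : Measure (C0 T)) (hμ : ∀ ε : ℝ, 0 < ε → μ {f | ε < ‖f.1‖} < ∞)
    (Φ : Ω → Mp T) (hΦ : IsPoissonRandomMeasure P μ Φ)
    (K : Set T) (hK : IsClosed K) (hK' : K.Nonempty)
    (A B : Set (Mp T)) (hA : MeasurableSet A) (hB : MeasurableSet B) :
    P {ω | (extremalPart K (Φ ω), subExtremalPart K (Φ ω)) ∈ A ×ˢ B ∧
          (extremalPart K (Φ ω)).1 Set.univ = 0} =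
        EReal.exp (-(μ Set.univ : EReal)) * Measure.dirac (0 : Mp T) A *
          Measure.dirac (0 : Mp T) B ∧
      ∀ k : ℕ, 1 ≤ k →
        P {ω | (extremalPart K (Φ ω), subExtremalPart K (Φ ω)) ∈ A ×ˢ B ∧
            (extremalPart K (Φ ω)).1 Set.univ = k} =
          (k.factorial : ℝ≥0∞)⁻¹ *
            ∫⁻ f : Fin k → C0 T,
              Set.indicator {f | sumDirac f ∈ A ∩ CPlus K}
                (fun f => P {ω | Φ ω ∈ B ∩ CMinus K (fun t => ⨆ i, (f i).1 t)}) f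
              ∂(Measure.pi fun _ : Fin k => μ) := by
  have hlev : ∀ n, μ (level T n) < ∞ := fun n => hμ _ Nat.one_div_pos_of_nat
  constructor
  -- Without extremal points `Φ ω` is null, so both parts are null and `A`, `B` matter only through
  -- whether they contain `0`.
  · have hset : {ω | (extremalPart K (Φ ω), subExtremalPart K (Φ ω)) ∈ A ×ˢ B ∧
        (extremalPart K (Φ ω)).1 Set.univ = 0} =
        {ω | Φ ω = 0 ∧ (0 : Mp T) ∈ A ∧ (0 : Mp T) ∈ B} := by
      ext ω
      simp only [Set.mem_ofPred_eq, extremalPart_apply_univ_eq_zero_iff hK', Set.mem_prod]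
      rw [and_comm]
      refine and_congr_right fun h => ?_
      have h0 : ∀ S, (0 : Mp T).restrict S = 0 := fun S =>
        Mp.restrict_eq_self 0 (by simp [atoms_zero])
      rw [h, extremalPart, subExtremalPart, h0, h0]
    rw [hset, Measure.dirac_apply' _ hA, Measure.dirac_apply' _ hB]
    by_cases h0A : (0 : Mp T) ∈ A
    · by_cases h0B : (0 : Mp T) ∈ B
      · simp [h0A, h0B, hΦ.measure_eq_zero]
      · simp [h0B]
    · simp [h0A]
  · intro k _
    simp only [Set.mem_prod, and_assoc]
    rw [hΦ.measure_extremal_card_eq hlev hK hK' hA hB k]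
    congr 1
    refine lintegral_congr fun f => ?_
    simp_rw [← maxFun_sumDirac]
    by_cases hf : sumDirac f ∈ A ∩ CPlus K
    · rw [Set.indicator_of_mem (by exact hf)]
      simp [splitEvent, hf.1, hf.2]
    · rw [Set.indicator_of_notMem (by exact hf)]
      have : {ω | (sumDirac f, Φ ω) ∈ splitEvent K A B} = ∅ :=
        Set.eq_empty_of_forall_notMem fun ω hω => hf hω.1
      rw [this, measure_empty]
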